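/- Let $d\ge 2$ and $r\ge 1$ be integers and let $P_k^+,P_k^-\in\mathbb R^{r\times r}$ ($k\in\mathbb Z$). Let $\phi:\mathbb R\to\mathbb C^r$ (or $\mathbb R\to\mathbb R^r$) be a two-direction multiscaling function with these coefficients, that is, $$\phi(x)=\sqrt d\sum_{k\in\mathbb Z}\bigl[P_k^+\phi(dx-k)+P_k^-\phi(k-dx)\bigr]\qquad(x\in\mathbb R),$$ and $\phi$ generates a multiresolution approximation of $L^2(\mathbb R)$: the closed spans $V_n$ ($n\in\mathbb Z$) of the functions $\phi_i(d^nx-k)$, $\phi_i(k-d^nx)$, $1\le i\le r$, $k\in\mathbb Z$, are nested ($V_n\subset V_{n+1}$), have dense union and trivial intersection, $f\in V_n\iff f(d\,\cdot)\in V_{n+1}$, $V_0$ is invariant under integer translations, and the functions $\phi_i(x-k)$, $\phi_i(k-x)$ form a Riesz basis of $V_0$. Assume that $\phi$ is continuous, has compact support, is orthogonal, that is, $$\int\phi(x-j)\phi(x-k)^*\,dx=\delta_{jk}I_r,\qquad \int\phi(x-j)\phi(k-x)^*\,dx=0\qquad(j,k\in\mathbb Z),$$ and satisfies Condition E: the matrix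 $$\frac1{\sqrt d}\sum_{k\in\mathbb Z}\begin{bmatrix}P_k^+&P_k^-\\P_{-k}^-&P_{-k}^+\end{bmatrix}$$ has $1$ as an eigenvalue of algebraic multiplicity one, and all its other eigenvalues are smaller than $1$ in absolute value. For $s=1,\dots,d-1$ let $Q_k^{(s)+},Q_k^{(s)-}\in\mathbb R^{r\times r}$ ($k\in\mathbb Z$) and $$\psi^{(s)}(x)=\sqrt d\sum_{k\in\mathbb Z}\bigl[Q_k^{(s)+}\phi(dx-k)+Q_k^{(s)-}\phi(k-dx)\bigr]\qquad(x\in\mathbb R).$$ Define the discrete moments $M_j^\pm=\frac1{\sqrt d}\sum_kk^jP_k^\pm$, $M_j=M_j^++M_j^-$, $N_j^{(s)\pm}=\frac1{\sqrt d}\sum_kk^jQ_k^{(s)\pm}$ and the continuous moments $\mathbf m_j=\int x^j\phi(x)\,dx$, $\mathbf n_j^{(s)}=\int x^j\psi^{(s)}(x)\,dx$, $j=0,1,2,\dots$. Then only finitely many $P_k^\pm$ are nonzero, all $x^j\phi$ are integrable, and the following hold. (a) $M_0\mathbf m_0=\mathbf m_0$ and $\mathbf m_0^*\mathbf m_0=\tfrac12$;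 these two conditions determine $\mathbf m_0$ up to a scalar factor of absolute value $1$. (b) For every $j\ge1$ the matrix $d^jI_r-[M_0^++(-1)^jM_0^-]$ is nonsingular and $$\mathbf m_j=\bigl(d^jI_r-[M_0^++(-1)^jM_0^-]\bigr)^{-1}\sum_{\ell=0}^{j-1}\binom j\ell\bigl[M_{j-\ell}^++(-1)^\ell M_{j-\ell}^-\bigr]\mathbf m_\ell .$$ (c) The sequence $(\mathbf m_j)_{j\ge0}$ is the only sequence of vectors that starts with $\mathbf m_0$ and satisfies the recursion in (b). (d) For all $s$ and all $j\ge0$ for which $x^j\psi^{(s)}$ is integrable (all $j$ if $\psi^{(s)}$ has compact support), the series defining $N_i^{(s)\pm}$, $0\le i\le j$, converge absolutely and $$\mathbf n_j^{(s)}=d^{-j}\sum_{\ell=0}^{j}\binom j\ell\bigl[N_{j-\ell}^{(s)+}+(-1)^\ell N_{j-\ell}^{(s)-}\bigr]\mathbf m_\ell .$$ -/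

import Mathlib

open MeasureTheory

namespace TwoDirection

noncomputable section

/-- A real matrix acting on a vector with entries in `𝕜` (`ℝ` or `ℂ`). -/
def act {𝕜 : Type*} [RCLike 𝕜] {r : ℕ} (A : Matrix (Fin r) (Fin r) ℝ) (v : Fin r → 𝕜) :
    Fin r → 𝕜 :=
  (A.map (algebraMap ℝ 𝕜)).mulVec v

/-- The two-direction relation
`f(x) = √d ∑_{k ∈ ℤ} [C⁺_k φ(d x - k) + C⁻_k φ(k - d x)]` for all real `x`.
With `f = φ` it is the two-direction refinement equation of `φ`; with `f = ψ⁽ˢ⁾` it is the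
relation that defines the two-direction multiwavelets associated with `φ`. -/
def Recursion {𝕜 : Type*} [RCLike 𝕜] {r : ℕ} (d : ℕ) (Cp Cm : ℤ → Matrix (Fin r) (Fin r) ℝ)
    (φ f : ℝ → Fin r → 𝕜) : Prop :=
  ∀ x : ℝ, HasSum
    (fun k : ℤ => Real.sqrt d • (act (Cp k) (φ (d * x - k)) + act (Cm k) (φ (k - d * x)))) (f x)

/-- The functions `φ_i(dⁿ x - k)` (tag `true`) and `φ_i(k - dⁿ x)` (tag `false`). -/
def shift {𝕜 : Type*} [RCLike 𝕜] {r : ℕ} (d : ℕ) (φ : ℝ → Fin r → 𝕜) (n : ℤ)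
    (p : Fin r × ℤ × Bool) : ℝ → 𝕜 := fun x =>
  if p.2.2 then φ ((d : ℝ) ^ n * x - p.2.1) p.1 else φ (p.2.1 - (d : ℝ) ^ n * x) p.1

/-- `V_n`: the closed linear span in `L²(ℝ)` of the functions
`φ_i(dⁿ x - k)` and `φ_i(k - dⁿ x)`, for all `i` and all integers `k`. -/
def scaleSpace {𝕜 : Type*} [RCLike 𝕜] {r : ℕ} (d : ℕ) (φ : ℝ → Fin r → 𝕜) (n : ℤ) :
    Submodule 𝕜 (Lp 𝕜 2 (volume : Measure ℝ)) :=
  (Submodule.span 𝕜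
    {f : Lp 𝕜 2 (volume : Measure ℝ) | ∃ p, f =ᵐ[volume] shift d φ n p}).topologicalClosure

/-- A multiresolution approximation of `L²(ℝ)` with dilation factor `d`. -/
structure IsMRA {𝕜 : Type*} [RCLike 𝕜] (d : ℕ)
    (V : ℤ → Submodule 𝕜 (Lp 𝕜 2 (volume : Measure ℝ))) : Prop where
  closed : ∀ n, IsClosed (V n : Set (Lp 𝕜 2 (volume : Measure ℝ)))
  nested : ∀ n, V n ≤ V (n + 1)
  dense : (⨆ n, V n).topologicalClosure = ⊤
  separated : ⨅ n, V n = ⊥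
  dilation : ∀ (n : ℤ) (f g : Lp 𝕜 2 (volume : Measure ℝ)),
    (g =ᵐ[volume] fun x => f (d * x)) → (f ∈ V n ↔ g ∈ V (n + 1))
  translation : ∀ (k : ℤ) (f g : Lp 𝕜 2 (volume : Measure ℝ)),
    (g =ᵐ[volume] fun x => f (x - k)) → f ∈ V 0 → g ∈ V 0

/-- `φ` generates a multiresolution approximation: the spaces `V_n` form one, and the functions
`φ_i(x - k)`, `φ_i(k - x)` are a stable (Riesz) basis of `V_0`. -/
def GeneratesMRA {𝕜 : Type*} [RCLike 𝕜] {r : ℕ} (d : ℕ) (φ : ℝ → Fin r → 𝕜) : Prop :=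
  IsMRA d (scaleSpace d φ) ∧
    (∀ p, MemLp (shift d φ 0 p) 2 volume) ∧
    ∃ A B : ℝ, 0 < A ∧ ∀ c : (Fin r × ℤ × Bool) →₀ 𝕜,
      A * ∑ p ∈ c.support, ‖c p‖ ^ 2 ≤ ∫ x, ‖∑ p ∈ c.support, c p * shift d φ 0 p x‖ ^ 2 ∧
      ∫ x, ‖∑ p ∈ c.support, c p * shift d φ 0 p x‖ ^ 2 ≤ B * ∑ p ∈ c.support, ‖c p‖ ^ 2

/-- A two-direction multiscaling function of multiplicity `r` and dilation factor `d` with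
recursion coefficients `P⁺_k`, `P⁻_k`. -/
structure IsMultiscaling {𝕜 : Type*} [RCLike 𝕜] {r : ℕ} (d : ℕ)
    (Pp Pm : ℤ → Matrix (Fin r) (Fin r) ℝ) (φ : ℝ → Fin r → 𝕜) : Prop where
  recursion : Recursion d Pp Pm φ φ
  mra : GeneratesMRA d φ

/-- The matrix-valued inner product `⟨f, g⟩ = ∫ f(x) g(x)^* dx`. -/
def gram {𝕜 : Type*} [RCLike 𝕜] {r : ℕ} (f g : ℝ → Fin r → 𝕜) : Matrix (Fin r) (Fin r) 𝕜 :=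
  Matrix.of fun a b => ∫ x, f x a * star (g x b)

/-- Orthogonality of `φ`: `⟨φ(x-j), φ(x-k)⟩ = δ_{jk} I_r` and `⟨φ(x-j), φ(k-x)⟩ = O`. -/
def Orthogonal {𝕜 : Type*} [RCLike 𝕜] {r : ℕ} (φ : ℝ → Fin r → 𝕜) : Prop :=
  ∀ j k : ℤ,
    gram (fun x => φ (x - j)) (fun x => φ (x - k)) = (if j = k then 1 else 0) ∧
    gram (fun x => φ (x - j)) (fun x => φ (k - x)) = 0

/-- Condition E for a square matrix: `1` is an eigenvalue of algebraic multiplicity one and all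
other complex eigenvalues are smaller than `1` in absolute value. -/
def ConditionE {ι : Type*} [Fintype ι] [DecidableEq ι] (A : Matrix ι ι ℂ) : Prop :=
  A.charpoly.rootMultiplicity 1 = 1 ∧ ∀ μ ∈ spectrum ℂ A, μ ≠ 1 → ‖μ‖ < 1

/-- The matrix `(1/√d) ∑_k [[P⁺_k, P⁻_k], [P⁻_{-k}, P⁺_{-k}]]`. -/
def doubledMask {r : ℕ} (d : ℕ) (Pp Pm : ℤ → Matrix (Fin r) (Fin r) ℝ) :
    Matrix (Fin r ⊕ Fin r) (Fin r ⊕ Fin r) ℝ :=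
  (1 / Real.sqrt d) • ∑' k : ℤ, Matrix.fromBlocks (Pp k) (Pm k) (Pm (-k)) (Pp (-k))

/-- The discrete moment `(1/√d) ∑_{k ∈ ℤ} k^j C_k` of a family of matrices. -/
def discreteMoment {r : ℕ} (d : ℕ) (C : ℤ → Matrix (Fin r) (Fin r) ℝ) (j : ℕ) :
    Matrix (Fin r) (Fin r) ℝ :=
  (1 / Real.sqrt d) • ∑' k : ℤ, (k : ℝ) ^ j • C k

/-- The continuous moment `∫ x^j f(x) dx`, a vector of size `r`. -/
def moment {𝕜 : Type*} [RCLike 𝕜] {r : ℕ} (f : ℝ → Fin r → 𝕜) (j : ℕ) : Fin r → 𝕜 :=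
  ∫ x : ℝ, (x ^ j) • f x

/-- The matrix `d^j I_r - [M_0⁺ + (-1)^j M_0⁻]`. -/
def sepMatrix {r : ℕ} (d : ℕ) (Pp Pm : ℤ → Matrix (Fin r) (Fin r) ℝ) (j : ℕ) :
    Matrix (Fin r) (Fin r) ℝ :=
  (d : ℝ) ^ j • (1 : Matrix (Fin r) (Fin r) ℝ) -
    (discreteMoment d Pp 0 + (-1 : ℝ) ^ j • discreteMoment d Pm 0)

/-- `binom(j, ℓ) [C⁺_{j-ℓ} + (-1)^ℓ C⁻_{j-ℓ}] v`, with `C^±_i` the discrete moments of the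
coefficient families. It is used for `ℓ ≤ j` only. -/
def sepTerm {𝕜 : Type*} [RCLike 𝕜] {r : ℕ} (d : ℕ) (Cp Cm : ℤ → Matrix (Fin r) (Fin r) ℝ)
    (j l : ℕ) (v : Fin r → 𝕜) : Fin r → 𝕜 :=
  (j.choose l : ℝ) •
    act (discreteMoment d Cp (j - l) + (-1 : ℝ) ^ l • discreteMoment d Cm (j - l)) v

end

end TwoDirection

open TwoDirection

/-! ### Real matrices acting on vectors, and the spectral consequences of Condition E. -/

namespace TwoDirection

variable {𝕜 : Type*} [RCLike 𝕜] {r : ℕ}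

/-! Orthogonality turns the coefficients of any two-direction relation into inner products, `√d ∫ f
φ(±(dx - k))^*` (`Recursion.coeff_eq`). For `f = φ` these vanish for large `|k|`, because the
supports separate. For general `f` the bounded overlap of the shifts dominates `∑ |k|^i |C_k|` by a
multiple of `∫ (1 + |x|^j) |f|`, so the discrete moments up to order `j` converge absolutely as soon
as `x^j f` is integrable (`Recursion.summable_pow_mul_coeff`). The relation may then be integrated
termwise against `x^j`, and a change of variables with the binomial theorem gives one moment formula
for both `φ` and the multiwavelets (`Recursion.moment_eq`).

For `f = φ` and `j = 0` the formula is the eigenvector equation for `m_0`. For `j ≥ 1` it becomes a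
recursion once the `ℓ = j` term is moved to the left. An eigenvector `v` of `M_0⁺ ± M_0⁻` lifts to
the eigenvector `(v, ±v)` of the doubled mask. Condition E therefore excludes the eigenvalue `d^j >
1` (`isUnit_sepMatrix`) and makes the eigenvectors for `1` proportional (`exists_smul_of_act_eq`).

The normalization comes from density of the spaces `V_n` (`sum_norm_sq_moment_zero`). The
projections onto `V_n` of the indicator of `[0,1]` have norms tending to `1`. In the orthonormal
basis of `V_n`, each component and each orientation contributes about `d^n` coefficients of squared
size `d^{-n} |m_{0,b}|^2`, and the two orientations give `2 |m_0|^2 = 1`. -/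

theorem act_apply (A : Matrix (Fin r) (Fin r) ℝ) (v : Fin r → 𝕜) (a : Fin r) :
    act A v a = ∑ b, (algebraMap ℝ 𝕜 (A a b)) * v b := rfl

theorem act_add_left (A B : Matrix (Fin r) (Fin r) ℝ) (v : Fin r → 𝕜) :
    act (A + B) v = act A v + act B v := by
  ext a
  simp [act_apply, add_mul, Finset.sum_add_distrib]

theorem act_sub_left (A B : Matrix (Fin r) (Fin r) ℝ) (v : Fin r → 𝕜) :
    act (A - B) v = act A v - act B v := by
  ext a
  simp [act_apply, sub_mul, Finset.sum_sub_distrib]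

theorem act_smul_left (c : ℝ) (A : Matrix (Fin r) (Fin r) ℝ) (v : Fin r → 𝕜) :
    act (c • A) v = c • act A v := by
  ext a
  simp [act_apply, mul_assoc, Finset.mul_sum, RCLike.real_smul_eq_coe_mul]

theorem act_zero_left (v : Fin r → 𝕜) : act 0 v = 0 := by
  ext a
  simp [act_apply]

theorem act_one (v : Fin r → 𝕜) : act 1 v = v := by
  ext a
  simp [act_apply, Matrix.one_apply]

theorem act_mul (A B : Matrix (Fin r) (Fin r) ℝ) (v : Fin r → 𝕜) :
    act (A * B) v = act A (act B v) := by
  simp [act, Matrix.map_mul, Matrix.mulVec_mulVec]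

theorem norm_act_le (A : Matrix (Fin r) (Fin r) ℝ) (v : Fin r → 𝕜) :
    ‖act A v‖ ≤ (∑ a, ∑ b, |A a b|) * ‖v‖ := by
  refine (pi_norm_le_iff_of_nonneg (by positivity)).2 fun a => ?_
  calc ‖∑ b, (algebraMap ℝ 𝕜 (A a b)) * v b‖
      ≤ ∑ b, ‖(algebraMap ℝ 𝕜 (A a b)) * v b‖ := norm_sum_le _ _
    _ ≤ ∑ b, |A a b| * ‖v‖ := by
        refine Finset.sum_le_sum fun b _ => ?_
        rw [norm_mul, norm_algebraMap', Real.norm_eq_abs]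
        exact mul_le_mul_of_nonneg_left (norm_le_pi_norm v b) (abs_nonneg _)
    _ = (∑ b, |A a b|) * ‖v‖ := by rw [Finset.sum_mul]
    _ ≤ _ := by
        exact mul_le_mul_of_nonneg_right (Finset.single_le_sum (f := fun a => ∑ b, |A a b|)
          (fun i _ => by positivity) (Finset.mem_univ a)) (norm_nonneg v)

/-- `act A` as a continuous real-linear map. -/
noncomputable def actCLM (A : Matrix (Fin r) (Fin r) ℝ) : (Fin r → 𝕜) →L[ℝ] (Fin r → 𝕜) :=
  (LinearMap.restrictScalars ℝ (Matrix.mulVecLin (A.map (algebraMap ℝ 𝕜)))).mkContinuous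
    (∑ a, ∑ b, |A a b|) (norm_act_le A)

theorem actCLM_apply (A : Matrix (Fin r) (Fin r) ℝ) (v : Fin r → 𝕜) : actCLM A v = act A v := rfl

/-- `act · v` as an additive map. -/
noncomputable def actLeft (v : Fin r → 𝕜) : Matrix (Fin r) (Fin r) ℝ →+ (Fin r → 𝕜) where
  toFun A := act A v
  map_zero' := act_zero_left v
  map_add' A B := act_add_left A B v

theorem continuous_actLeft (v : Fin r → 𝕜) : Continuous (actLeft v) := by
  change Continuous fun A : Matrix (Fin r) (Fin r) ℝ => (A.map (algebraMap ℝ 𝕜)).mulVec v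
  exact (continuous_id.matrix_map RCLike.continuous_ofReal).matrix_mulVec continuous_const

theorem hasSum_act {ι : Type*} {A : ι → Matrix (Fin r) (Fin r) ℝ} {S : Matrix (Fin r) (Fin r) ℝ}
    (h : HasSum A S) (v : Fin r → 𝕜) : HasSum (fun k => act (A k) v) (act S v) :=
  h.map (actLeft v) (continuous_actLeft v)

theorem hasSum_matrix_iff {ι m n : Type*} {A : ι → Matrix m n ℝ} {S : Matrix m n ℝ} :
    HasSum A S ↔ ∀ a b, HasSum (fun k => A k a b) (S a b) :=
  Pi.hasSum.trans (forall_congr' fun _ => Pi.hasSum)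

theorem summable_matrix_iff {ι m n : Type*} {A : ι → Matrix m n ℝ} :
    Summable A ↔ ∀ a b, Summable (fun k => A k a b) :=
  Pi.summable.trans (forall_congr' fun _ => Pi.summable)

/-- Reindexing by `k ↦ -k` does not change the sums in the lower blocks. -/
theorem doubledMask_eq {d : ℕ} {Pp Pm : ℤ → Matrix (Fin r) (Fin r) ℝ}
    (hp : Summable Pp) (hm : Summable Pm) :
    doubledMask d Pp Pm = Matrix.fromBlocks (discreteMoment d Pp 0) (discreteMoment d Pm 0)
      (discreteMoment d Pm 0) (discreteMoment d Pp 0) := by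
  have hp' : HasSum (fun k => Pp (-k)) (∑' k, Pp k) :=
    (Equiv.neg ℤ).hasSum_iff.2 hp.hasSum
  have hm' : HasSum (fun k => Pm (-k)) (∑' k, Pm k) :=
    (Equiv.neg ℤ).hasSum_iff.2 hm.hasSum
  have key : HasSum (fun k => Matrix.fromBlocks (Pp k) (Pm k) (Pm (-k)) (Pp (-k)))
      (Matrix.fromBlocks (∑' k, Pp k) (∑' k, Pm k) (∑' k, Pm k) (∑' k, Pp k)) := by
    rw [hasSum_matrix_iff]
    rintro (a | a) (b | b)
    · exact hasSum_matrix_iff.1 hp.hasSum a b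
    · exact hasSum_matrix_iff.1 hm.hasSum a b
    · exact hasSum_matrix_iff.1 hm' a b
    · exact hasSum_matrix_iff.1 hp' a b
  simp only [doubledMask, discreteMoment, pow_zero, one_smul, key.tsum_eq,
    Matrix.fromBlocks_smul]

/-- An eigenvector `v` of `B + ε C`, `ε = ±1`, gives the eigenvector `(v, ε v)` of the block matrix
`[[B, C], [C, B]]`. -/
theorem fromBlocks_mulVec_elim {K : Type*} [CommRing K] {n : Type*} [Fintype n]
    (B C : Matrix n n K) {ε μ : K} (hε : ε * ε = 1) {v : n → K}
    (hv : (B + ε • C).mulVec v = μ • v) :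
    (Matrix.fromBlocks B C C B).mulVec (Sum.elim v (ε • v)) = μ • Sum.elim v (ε • v) := by
  have h1 : B.mulVec v + ε • C.mulVec v = μ • v := by
    rw [← hv, Matrix.add_mulVec, Matrix.smul_mulVec]
  rw [Matrix.fromBlocks_mulVec]
  ext (a | a)
  · have := congrFun h1 a
    simpa [Matrix.mulVec_smul] using this
  · have := congrFun h1 a
    simp only [Pi.add_apply, Pi.smul_apply, smul_eq_mul] at this
    simp only [Matrix.mulVec_smul, Sum.elim_inr, Pi.add_apply, Pi.smul_apply, smul_eq_mul,
      Sum.elim_comp_inl, Sum.elim_comp_inr]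
    linear_combination ε * this - (C.mulVec v a) * hε

/-- A kernel vector would be an eigenvector of `M_0⁺ + (-1)^j M_0⁻` for `d^j`. Its lift with `ε =
(-1)^j` makes `d^j > 1` an eigenvalue of the doubled mask, against Condition E. -/
theorem isUnit_sepMatrix {d : ℕ} (hd : 2 ≤ d) {Pp Pm : ℤ → Matrix (Fin r) (Fin r) ℝ}
    (hp : Summable Pp) (hm : Summable Pm)
    (hE : ConditionE ((doubledMask d Pp Pm).map (algebraMap ℝ ℂ))) {j : ℕ} (hj : 1 ≤ j) :
    IsUnit (sepMatrix d Pp Pm j) := by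
  rw [Matrix.isUnit_iff_isUnit_det, isUnit_iff_ne_zero]
  intro h0
  obtain ⟨v, hv0, hv⟩ := Matrix.exists_mulVec_eq_zero_iff.2 h0
  have hv' : (discreteMoment d Pp 0 + (-1 : ℝ) ^ j • discreteMoment d Pm 0).mulVec v
      = (d : ℝ) ^ j • v := by
    rw [sepMatrix, Matrix.sub_mulVec, Matrix.smul_mulVec, Matrix.one_mulVec, sub_eq_zero] at hv
    exact hv.symm
  have hev := fromBlocks_mulVec_elim _ _ (by rw [← pow_add, ← two_mul, pow_mul]; simp) hv'
  rw [← doubledMask_eq hp hm] at hev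
  have hroot : (doubledMask d Pp Pm).charpoly.IsRoot ((d : ℝ) ^ j) := by
    rw [← Matrix.mem_spectrum_iff_isRoot_charpoly, ← Matrix.spectrum_toLin',
      ← Module.End.hasEigenvalue_iff_mem_spectrum]
    refine Module.End.hasEigenvalue_of_hasEigenvector
      (x := Sum.elim v ((-1 : ℝ) ^ j • v)) ⟨?_, ?_⟩
    · rw [Module.End.mem_eigenspace_iff, Matrix.toLin'_apply, hev]
    · intro h
      exact hv0 (funext fun a => congrFun h (Sum.inl a))
  have hmem : (algebraMap ℝ ℂ ((d : ℝ) ^ j)) ∈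
      spectrum ℂ ((doubledMask d Pp Pm).map (algebraMap ℝ ℂ)) := by
    rw [Matrix.mem_spectrum_iff_isRoot_charpoly, Matrix.charpoly_map]
    exact hroot.map
  have hd1 : (1 : ℝ) < (d : ℝ) ^ j := one_lt_pow₀ (by exact_mod_cast hd) (by omega)
  have hlt := hE.2 _ hmem (by
    intro h
    rw [← map_one (algebraMap ℝ ℂ)] at h
    exact hd1.ne' ((algebraMap ℝ ℂ).injective h))
  rw [norm_algebraMap', Real.norm_of_nonneg (by positivity)] at hlt
  exact absurd hlt hd1.le.not_gt

/-- Under Condition E the eigenspace of `M_0` for the eigenvalue `1` is at most a line. -/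
theorem exists_smul_of_act_eq {d : ℕ} {Pp Pm : ℤ → Matrix (Fin r) (Fin r) ℝ}
    (hp : Summable Pp) (hm : Summable Pm)
    (hE : ConditionE ((doubledMask d Pp Pm).map (algebraMap ℝ ℂ))) {v w : Fin r → 𝕜}
    (hv : act (discreteMoment d Pp 0 + discreteMoment d Pm 0) v = v)
    (hw : act (discreteMoment d Pp 0 + discreteMoment d Pm 0) w = w) (hw0 : w ≠ 0) :
    ∃ c : 𝕜, v = c • w := by
  set D := (doubledMask d Pp Pm).map (algebraMap ℝ 𝕜) with hD
  -- The characteristic polynomial is real, and root multiplicities at real points survive injective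
  -- field maps, so the count passes from `ℂ` through `ℝ` to `𝕜`.
  have hmult : D.charpoly.rootMultiplicity 1 = 1 := by
    have h1 := hE.1
    rw [Matrix.charpoly_map, ← map_one (algebraMap ℝ ℂ),
      ← Polynomial.eq_rootMultiplicity_map (algebraMap ℝ ℂ).injective] at h1
    rw [hD, Matrix.charpoly_map, ← map_one (algebraMap ℝ 𝕜),
      ← Polynomial.eq_rootMultiplicity_map (algebraMap ℝ 𝕜).injective, h1]
  have hmem : ∀ u : Fin r → 𝕜, act (discreteMoment d Pp 0 + discreteMoment d Pm 0) u = u →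
      Sum.elim u u ∈ Module.End.eigenspace (Matrix.toLin' D) 1 := by
    intro u hu
    rw [Module.End.mem_eigenspace_iff, Matrix.toLin'_apply, hD, doubledMask_eq hp hm,
      Matrix.fromBlocks_map]
    have := fromBlocks_mulVec_elim ((discreteMoment d Pp 0).map (algebraMap ℝ 𝕜))
      ((discreteMoment d Pm 0).map (algebraMap ℝ 𝕜)) (ε := 1) (μ := 1) (v := u) (by simp) (by
        rw [act, Matrix.map_add _ (map_add _)] at hu
        rw [one_smul, one_smul, hu])
    simpa using this
  -- Geometric multiplicity is at most algebraic multiplicity.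
  have hfin : Module.finrank 𝕜 (Module.End.eigenspace (Matrix.toLin' D) 1) ≤ 1 := by
    have := LinearMap.finrank_eigenspace_le (Matrix.toLin' D) 1
    rwa [Matrix.charpoly_toLin', hmult] at this
  obtain ⟨⟨g, hg⟩, hgen⟩ := finrank_le_one_iff.1 hfin
  obtain ⟨a, ha⟩ := hgen ⟨_, hmem v hv⟩
  obtain ⟨b, hb⟩ := hgen ⟨_, hmem w hw⟩
  have ha' : a • g = Sum.elim v v := congrArg Subtype.val ha
  have hb' : b • g = Sum.elim w w := congrArg Subtype.val hb
  have hb0 : b ≠ 0 := by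
    rintro rfl
    exact hw0 (funext fun i => by simpa using (congrFun hb' (Sum.inl i)).symm)
  refine ⟨a / b, funext fun i => ?_⟩
  have h1 := congrFun ha' (Sum.inl i)
  have h2 := congrFun hb' (Sum.inl i)
  simp only [Pi.smul_apply, Sum.elim_inl, smul_eq_mul] at h1 h2 ⊢
  rw [← h1, ← h2]
  field_simp

end TwoDirection

/-! ### Shifts and reflections of `φ`, and the coefficients of a two-direction relation. -/

namespace TwoDirection

variable {𝕜 : Type*} [RCLike 𝕜] {d r : ℕ} {φ : ℝ → Fin r → 𝕜}

/-- The sign `+1` (tag `true`) or `-1` (tag `false`). -/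
noncomputable def tagSign (σ : Bool) : ℝ := if σ then 1 else -1

theorem tagSign_mul_self (σ : Bool) : tagSign σ * tagSign σ = 1 := by
  cases σ <;> simp [tagSign]

theorem abs_tagSign (σ : Bool) : |tagSign σ| = 1 := by
  cases σ <;> simp [tagSign]

theorem shift_eq_tagSign (n : ℤ) (p : Fin r × ℤ × Bool) (x : ℝ) :
    shift d φ n p x = φ (tagSign p.2.2 * ((d : ℝ) ^ n * x - p.2.1)) p.1 := by
  obtain ⟨b, k, σ⟩ := p
  cases σ <;> simp [shift, tagSign]

theorem continuous_shift (hcont : Continuous φ) (n : ℤ) (p : Fin r × ℤ × Bool) :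
    Continuous (shift d φ n p) := by
  have : shift d φ n p = fun x => φ (tagSign p.2.2 * ((d : ℝ) ^ n * x - p.2.1)) p.1 :=
    funext (shift_eq_tagSign n p)
  rw [this]
  fun_prop

theorem shift_eq_zero {R : ℕ} (hR : ∀ y, (R : ℝ) < |y| → φ y = 0) {n : ℤ}
    {p : Fin r × ℤ × Bool} {x : ℝ} (h : (R : ℝ) < |(d : ℝ) ^ n * x - p.2.1|) :
    shift d φ n p x = 0 := by
  rw [shift_eq_tagSign, hR _ (by rwa [abs_mul, abs_tagSign, one_mul]), Pi.zero_apply]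

theorem exists_support_bound (hsupp : HasCompactSupport φ) :
    ∃ R : ℕ, ∀ y, (R : ℝ) < |y| → φ y = 0 := by
  obtain ⟨R, hR⟩ := hsupp.isCompact.isBounded.subset_closedBall 0
  obtain ⟨N, hN⟩ := exists_nat_ge R
  refine ⟨N, fun y hy => ?_⟩
  by_contra h
  have := hR (subset_tsupport φ h)
  rw [Metric.mem_closedBall, dist_zero_right, Real.norm_eq_abs] at this
  linarith

theorem hasCompactSupport_of_abs {E : Type*} [Zero E] {g : ℝ → E} {T : ℝ}
    (h : ∀ x, T < |x| → g x = 0) : HasCompactSupport g :=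
  HasCompactSupport.intro (isCompact_closedBall (0 : ℝ) T) fun x hx => h x (by
    simpa [Metric.mem_closedBall] using hx)

theorem abs_le_of_abs_sub_le (hd : 1 ≤ d) {x k R : ℝ} {n : ℕ}
    (h : |(d : ℝ) ^ n * x - k| ≤ R) : |x| ≤ |k| + R := by
  have h1 : |(d : ℝ) ^ n * x| ≤ |k| + R := by
    calc |(d : ℝ) ^ n * x| = |k + ((d : ℝ) ^ n * x - k)| := by ring_nf
      _ ≤ |k| + |(d : ℝ) ^ n * x - k| := abs_add_le _ _
      _ ≤ _ := by gcongr
  have h2 : (1 : ℝ) ≤ (d : ℝ) ^ n := one_le_pow₀ (by exact_mod_cast hd)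
  rw [abs_mul, abs_of_nonneg (by positivity)] at h1
  nlinarith [abs_nonneg x]

theorem hasCompactSupport_shift (hd : 1 ≤ d) {R : ℕ} (hR : ∀ y, (R : ℝ) < |y| → φ y = 0) (n : ℕ)
    (p : Fin r × ℤ × Bool) : HasCompactSupport (shift d φ n p) := by
  refine hasCompactSupport_of_abs (T := |(p.2.1 : ℝ)| + R) fun x hx => shift_eq_zero hR ?_
  by_contra h
  rw [zpow_natCast] at h
  exact absurd (abs_le_of_abs_sub_le hd (not_lt.1 h)) (not_le.2 hx)

/-- Two reflected functions reduce to two translates by `y ↦ -y`; a reflected function against a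
translate is the conjugate of the mixed product in the hypothesis. -/
theorem integral_shift_zero_mul_star (horth : TwoDirection.Orthogonal φ)
    (p q : Fin r × ℤ × Bool) :
    ∫ y, φ (tagSign p.2.2 * (y - p.2.1)) p.1 * star (φ (tagSign q.2.2 * (y - q.2.1)) q.1)
      = if p = q then 1 else 0 := by
  obtain ⟨b, k, σ⟩ := p
  obtain ⟨c, l, τ⟩ := q
  have same : ∀ k l : ℤ, ∫ y, φ (y - k) b * star (φ (y - l) c)
      = if b = c ∧ k = l then 1 else 0 := by
    intro k l
    have h := congrFun (congrFun (horth k l).1 b) c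
    simp only [gram, Matrix.of_apply] at h
    rw [h]
    by_cases hkl : k = l <;> simp [hkl, Matrix.one_apply]
  have mixed : ∀ (b c : Fin r) (k l : ℤ), ∫ y, φ (y - k) b * star (φ (l - y) c) = 0 := by
    intro b c k l
    have h := congrFun (congrFun (horth k l).2 b) c
    simpa only [gram, Matrix.of_apply, Matrix.zero_apply] using h
  cases σ <;> cases τ <;> simp only [tagSign, Prod.mk.injEq, and_true, if_true, one_mul, neg_mul,
    neg_sub, reduceCtorEq, and_false, if_false, Bool.false_eq_true]
  · rw [← integral_neg_eq_self (fun y : ℝ => φ ((k : ℝ) - y) b * star (φ ((l : ℝ) - y) c))]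
    have h := same (-k) (-l)
    simp only [neg_inj] at h
    rw [← h]
    refine integral_congr_ae (Filter.Eventually.of_forall fun y => ?_)
    simp [add_comm]
  · have h : ∫ y, φ ((k : ℝ) - y) b * star (φ (y - l) c)
        = star (∫ y, φ (y - l) c * star (φ ((k : ℝ) - y) b)) := by
      rw [← starRingEnd_apply, ← integral_conj]
      refine integral_congr_ae (Filter.Eventually.of_forall fun y => ?_)
      simp [mul_comm]
    rw [h, mixed, star_zero]
  · exact mixed b c k l
  · exact same k l

theorem integral_shift_mul_star (horth : TwoDirection.Orthogonal φ) (n : ℤ)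
    (p q : Fin r × ℤ × Bool) :
    ∫ x, shift d φ n p x * star (shift d φ n q x)
      = if p = q then algebraMap ℝ 𝕜 ((d : ℝ) ^ n)⁻¹ else 0 := by
  simp only [shift_eq_tagSign]
  rw [Measure.integral_comp_mul_left (fun y => φ (tagSign p.2.2 * (y - p.2.1)) p.1 *
    star (φ (tagSign q.2.2 * (y - q.2.1)) q.1)), integral_shift_zero_mul_star horth,
    abs_of_nonneg (by positivity)]
  split_ifs
  · rw [Algebra.algebraMap_eq_smul_one]
  · simp

/-- The pair of coefficient families, indexed by the tag. -/
def coeff (Cp Cm : ℤ → Matrix (Fin r) (Fin r) ℝ) (σ : Bool) : ℤ → Matrix (Fin r) (Fin r) ℝ :=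
  if σ then Cp else Cm

/-- The summand of a two-direction relation. -/
noncomputable def recTerm (d : ℕ) (Cp Cm : ℤ → Matrix (Fin r) (Fin r) ℝ) (φ : ℝ → Fin r → 𝕜)
    (k : ℤ) (x : ℝ) : Fin r → 𝕜 :=
  Real.sqrt d • (act (Cp k) (φ (d * x - k)) + act (Cm k) (φ (k - d * x)))

variable {Cp Cm : ℤ → Matrix (Fin r) (Fin r) ℝ} {f : ℝ → Fin r → 𝕜}

theorem recTerm_apply (k : ℤ) (x : ℝ) (a : Fin r) :
    recTerm d Cp Cm φ k x a = ∑ q : Fin r × Bool,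
      algebraMap ℝ 𝕜 (Real.sqrt d) * algebraMap ℝ 𝕜 (coeff Cp Cm q.2 k a q.1) *
        shift d φ 1 (q.1, k, q.2) x := by
  rw [Fintype.sum_prod_type]
  simp only [recTerm, Pi.smul_apply, Pi.add_apply, act_apply, Fintype.sum_bool, coeff, shift,
    zpow_one, if_true, Bool.false_eq_true, if_false, Algebra.smul_def, mul_add, Finset.mul_sum,
    Finset.sum_add_distrib, mul_assoc]

theorem continuous_recTerm (hcont : Continuous φ) (k : ℤ) :
    Continuous (recTerm d Cp Cm φ k) := by
  have h1 : Continuous fun x : ℝ => act (Cp k) (φ (d * x - k)) :=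
    (actCLM (𝕜 := 𝕜) (Cp k)).continuous.comp (hcont.comp (by fun_prop))
  have h2 : Continuous fun x : ℝ => act (Cm k) (φ (k - d * x)) :=
    (actCLM (𝕜 := 𝕜) (Cm k)).continuous.comp (hcont.comp (by fun_prop))
  exact (h1.add h2).const_smul (Real.sqrt d)

theorem recTerm_eq_zero {R : ℕ} (hR : ∀ y, (R : ℝ) < |y| → φ y = 0) {k : ℤ} {x : ℝ}
    (h : (R : ℝ) < |(d : ℝ) * x - k|) : recTerm d Cp Cm φ k x = 0 := by
  ext a
  rw [recTerm_apply]
  refine Finset.sum_eq_zero fun q _ => ?_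
  rw [shift_eq_zero hR (by simpa using h), mul_zero]

/-- Only `k` with `|dx - k| ≤ R` contribute, so the series is locally a finite sum. This yields
continuity of `f` and interchange of sum and integral over bounded sets. -/
theorem Recursion.eq_sum {R : ℕ} (hR : ∀ y, (R : ℝ) < |y| → φ y = 0)
    (hf : Recursion d Cp Cm φ f) {N : ℕ} {x : ℝ} (hN : d * |x| + R ≤ N) :
    f x = ∑ k ∈ Finset.Icc (-N : ℤ) N, recTerm d Cp Cm φ k x := by
  refine (hf x).unique (hasSum_sum_of_ne_finset_zero fun k hk => ?_)
  refine recTerm_eq_zero hR ?_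
  by_contra h
  apply hk
  have h1 : |(k : ℝ)| ≤ N := by
    calc |(k : ℝ)| = |d * x - (d * x - k)| := by ring_nf
      _ ≤ |d * x| + |d * x - k| := abs_sub _ _
      _ ≤ d * |x| + R := by
        rw [abs_mul, Nat.abs_cast]
        gcongr
        exact not_lt.1 h
      _ ≤ N := hN
  rw [Finset.mem_Icc, ← abs_le]
  exact_mod_cast h1

theorem Recursion.continuous {R : ℕ} (hR : ∀ y, (R : ℝ) < |y| → φ y = 0) (hcont : Continuous φ)
    (hf : Recursion d Cp Cm φ f) : Continuous f := by
  rw [continuous_iff_continuousAt]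
  intro x
  obtain ⟨N, hN⟩ := exists_nat_ge ((d : ℝ) * (|x| + 1) + R)
  have hev : (fun y => ∑ k ∈ Finset.Icc (-N : ℤ) N, recTerm d Cp Cm φ k y) =ᶠ[nhds x] f := by
    filter_upwards [Metric.ball_mem_nhds x one_pos] with y hy
    refine (hf.eq_sum hR (le_trans ?_ hN)).symm
    gcongr
    rw [Metric.mem_ball, Real.dist_eq] at hy
    linarith [abs_sub_abs_le_abs_sub y x]
  exact ((continuous_finsetSum _ fun k _ => continuous_recTerm hcont k).continuousAt).congr hev

/-- The recursion coefficients are inner products. -/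
theorem Recursion.coeff_eq (hd : 1 ≤ d) (horth : TwoDirection.Orthogonal φ)
    {R : ℕ} (hR : ∀ y, (R : ℝ) < |y| → φ y = 0) (hcont : Continuous φ)
    (hf : Recursion d Cp Cm φ f) (a b : Fin r) (k : ℤ) (σ : Bool) :
    algebraMap ℝ 𝕜 (coeff Cp Cm σ k a b)
      = algebraMap ℝ 𝕜 (Real.sqrt d) * ∫ x, f x a * star (shift d φ 1 (b, k, σ) x) := by
  have hd0 : (0 : ℝ) < d := by exact_mod_cast hd
  -- On the support of the shift with index `k` one has `d|x| ≤ |k| + R`; the second `R` meets the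
  -- bound in `Recursion.eq_sum`, so one finite sum serves all relevant `x`.
  obtain ⟨N, hN⟩ := exists_nat_ge (|(k : ℝ)| + R + R)
  have hkN : k ∈ Finset.Icc (-N : ℤ) N := by
    rw [Finset.mem_Icc, ← abs_le]
    have h1 : |(k : ℝ)| ≤ N := by linarith [Nat.cast_nonneg (α := ℝ) R]
    exact_mod_cast h1
  have hpt : ∀ x, f x a * star (shift d φ 1 (b, k, σ) x) =
      ∑ l ∈ Finset.Icc (-N : ℤ) N, ∑ q : Fin r × Bool,
        algebraMap ℝ 𝕜 (Real.sqrt d) * algebraMap ℝ 𝕜 (coeff Cp Cm q.2 l a q.1) *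
        (shift d φ 1 (q.1, l, q.2) x * star (shift d φ 1 (b, k, σ) x)) := by
    intro x
    by_cases hx : (R : ℝ) < |(d : ℝ) * x - k|
    · simp [shift_eq_zero (n := 1) (p := (b, k, σ)) hR (by simpa using hx)]
    · have h1 : (d : ℝ) * |x| + R ≤ N := by
        refine le_trans ?_ hN
        rw [← Nat.abs_cast d, ← abs_mul]
        have : |(d : ℝ) * x| ≤ |(k : ℝ)| + |(d : ℝ) * x - k| := by
          calc |(d : ℝ) * x| = |(k : ℝ) + (d * x - k)| := by ring_nf
            _ ≤ _ := abs_add_le _ _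
        linarith [not_lt.1 hx]
      rw [hf.eq_sum hR h1, Finset.sum_apply, Finset.sum_mul]
      refine Finset.sum_congr rfl fun l _ => ?_
      rw [recTerm_apply, Finset.sum_mul]
      exact Finset.sum_congr rfl fun q _ => by ring
  have hint : ∀ p, Integrable (fun x => shift d φ 1 p x * star (shift d φ 1 (b, k, σ) x)) := by
    intro p
    refine Continuous.integrable_of_hasCompactSupport
      ((continuous_shift hcont 1 p).mul (continuous_shift hcont 1 _).star) ?_
    exact (hasCompactSupport_shift hd hR 1 p).mul_right
  simp_rw [hpt]
  rw [integral_finsetSum _ fun l _ => integrable_finsetSum _ fun q _ => (hint _).const_mul _]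
  simp_rw [integral_finsetSum _ fun q _ => (hint _).const_mul _, integral_const_mul,
    integral_shift_mul_star horth]
  rw [Finset.sum_eq_single_of_mem k hkN, Finset.sum_eq_single_of_mem (b, σ) (Finset.mem_univ _)]
  · have h2 : Real.sqrt d * (Real.sqrt d * (d : ℝ)⁻¹) = 1 := by
      rw [← mul_assoc, Real.mul_self_sqrt hd0.le, mul_inv_cancel₀ hd0.ne']
    rw [if_pos rfl, zpow_one, mul_right_comm, ← mul_assoc, ← map_mul, ← map_mul, h2, map_one,
      one_mul]
  · rintro ⟨c, τ⟩ _ hne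
    rw [if_neg, mul_zero]
    rintro h
    simp only [Prod.mk.injEq] at h
    exact hne (by rw [h.1, h.2.2])
  · intro l _ hne
    refine Finset.sum_eq_zero fun q _ => ?_
    rw [if_neg, mul_zero]
    rintro h
    simp only [Prod.mk.injEq] at h
    exact hne h.2.1

end TwoDirection

/-! ### Decay of the coefficients and the moment formula. -/

namespace TwoDirection

variable {𝕜 : Type*} [RCLike 𝕜] {d r : ℕ} {φ : ℝ → Fin r → 𝕜}
  {Cp Cm : ℤ → Matrix (Fin r) (Fin r) ℝ} {f : ℝ → Fin r → 𝕜}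

/-- For `|k| > dR + R` the supports of `φ` and of `φ(±(dx - k))` are disjoint, so the inner product
giving the coefficient is zero. -/
theorem Recursion.coeff_eq_zero (hd : 1 ≤ d) (horth : TwoDirection.Orthogonal φ)
    {R : ℕ} (hR : ∀ y, (R : ℝ) < |y| → φ y = 0) (hcont : Continuous φ)
    (hf : Recursion d Cp Cm φ φ) {k : ℤ} (hk : ((d * R + R : ℕ) : ℤ) < |k|) (σ : Bool) :
    coeff Cp Cm σ k = 0 := by
  ext a b
  apply (algebraMap ℝ 𝕜).injective
  rw [hf.coeff_eq hd horth hR hcont, Matrix.zero_apply, map_zero]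
  have : ∀ x, φ x a * star (shift d φ 1 (b, k, σ) x) = 0 := by
    intro x
    by_cases hx : (R : ℝ) < |x|
    · rw [hR x hx, Pi.zero_apply, zero_mul]
    · rw [shift_eq_zero hR, star_zero, mul_zero]
      have hk' : (d : ℝ) * R + R < |(k : ℝ)| := by exact_mod_cast hk
      have h1 : |(k : ℝ)| ≤ |(d : ℝ) * x| + |(d : ℝ) * x - k| := by
        calc |(k : ℝ)| = |d * x - (d * x - k)| := by ring_nf
          _ ≤ _ := abs_sub _ _
      have h2 : |(d : ℝ) * x| ≤ d * R := by
        rw [abs_mul, Nat.abs_cast]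
        gcongr
        exact not_lt.1 hx
      rw [zpow_one]
      change (R : ℝ) < |(d : ℝ) * x - k|
      linarith
  simp_rw [this]
  simp

theorem Recursion.finite_support (hd : 1 ≤ d) (horth : TwoDirection.Orthogonal φ)
    {R : ℕ} (hR : ∀ y, (R : ℝ) < |y| → φ y = 0) (hcont : Continuous φ)
    (hf : Recursion d Cp Cm φ φ) (σ : Bool) : (Function.support (coeff Cp Cm σ)).Finite := by
  refine (Set.finite_Icc (-((d * R + R : ℕ) : ℤ)) ((d * R + R : ℕ) : ℤ)).subset fun k hk => ?_
  rw [Set.mem_Icc, ← abs_le]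
  by_contra h
  exact hk (hf.coeff_eq_zero hd horth hR hcont (not_le.1 h) σ)

/-- Near the origin continuity suffices; off `[-1,1]` the factor `|x|^j` is at least `1`. -/
theorem integrable_of_integrable_pow_smul (hf : Continuous f) {j : ℕ}
    (hj : Integrable fun x : ℝ => x ^ j • f x) : Integrable f := by
  have hloc : Integrable ((Set.Icc (-1 : ℝ) 1).indicator fun x => ‖f x‖) :=
    (hf.norm.continuousOn.integrableOn_compact isCompact_Icc).integrable_indicator
      measurableSet_Icc
  refine (hloc.add hj.norm).mono' hf.aestronglyMeasurable (Filter.Eventually.of_forall fun x => ?_)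
  by_cases hx : x ∈ Set.Icc (-1 : ℝ) 1
  · simp [Set.indicator_of_mem hx]
  · have h1 : 1 ≤ |x| := by
      by_contra h
      exact hx (abs_le.1 (not_le.1 h).le)
    simp only [Pi.add_apply, Set.indicator_of_notMem hx, zero_add, norm_smul, norm_pow,
      Real.norm_eq_abs]
    exact le_mul_of_one_le_left (norm_nonneg _) (one_le_pow₀ h1)

theorem add_pow_le_mul_one_add_pow {a c t : ℝ} (ha : 0 ≤ a) (hc : 0 ≤ c) (ht : 0 ≤ t) {i j : ℕ}
    (hij : i ≤ j) : (a * t + c) ^ i ≤ (a + c) ^ i * 2 ^ (j - 1) * (1 + t ^ j) := by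
  calc (a * t + c) ^ i ≤ ((a + c) * (1 + t)) ^ i := by
        gcongr
        nlinarith
    _ = (a + c) ^ i * (1 + t) ^ i := mul_pow _ _ _
    _ ≤ (a + c) ^ i * (1 + t) ^ j := by
        gcongr
        linarith
    _ ≤ (a + c) ^ i * (2 ^ (j - 1) * (1 ^ j + t ^ j)) := by
        gcongr
        exact add_pow_le zero_le_one ht j
    _ = _ := by rw [one_pow, mul_assoc]

/-- At each point only boundedly many integer shifts of a compactly supported function overlap. -/
theorem sum_pow_mul_norm_shift_le {R : ℕ} (hR : ∀ y, (R : ℝ) < |y| → φ y = 0) {B : ℝ}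
    (hB : ∀ y, ‖φ y‖ ≤ B) (b : Fin r) (σ : Bool) (i : ℕ) (u : Finset ℤ) (x : ℝ) :
    ∑ k ∈ u, |(k : ℝ)| ^ i * ‖shift d φ 1 (b, k, σ) x‖
      ≤ (2 * R + 2) * (((d : ℝ) * |x| + R) ^ i * B) := by
  have hB0 : 0 ≤ B := (norm_nonneg _).trans (hB 0)
  -- Every `k` with `|dx - k| ≤ R` lies in this window of `2R + 2` integers around `⌊dx⌋`.
  set W := Finset.Icc (⌊(d : ℝ) * x⌋ - R) (⌊(d : ℝ) * x⌋ + 1 + R) with hW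
  have hcard : (W.card : ℝ) = 2 * R + 2 := by
    rw [hW, Int.card_Icc]
    have : ⌊(d : ℝ) * x⌋ + 1 + R + 1 - (⌊(d : ℝ) * x⌋ - R) = ((2 * R + 2 : ℕ) : ℤ) := by
      push_cast
      ring
    rw [this, Int.toNat_natCast]
    push_cast
    ring
  have hterm : ∀ k : ℤ, |(k : ℝ)| ^ i * ‖shift d φ 1 (b, k, σ) x‖
      ≤ if k ∈ W then ((d : ℝ) * |x| + R) ^ i * B else 0 := by
    intro k
    by_cases hx : (R : ℝ) < |(d : ℝ) * x - k|
    · rw [shift_eq_zero hR (by simpa using hx), norm_zero, mul_zero]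
      split_ifs <;> positivity
    · have hx' := not_lt.1 hx
      have hx2 := abs_le.1 hx'
      have hk : k ∈ W := by
        rw [hW, Finset.mem_Icc]
        have h1 := Int.floor_le ((d : ℝ) * x)
        have h2 := Int.lt_floor_add_one ((d : ℝ) * x)
        constructor
        · have : ((⌊(d : ℝ) * x⌋ - R : ℤ) : ℝ) ≤ k := by
            push_cast
            linarith [hx2.2]
          exact_mod_cast this
        · have : (k : ℝ) ≤ ((⌊(d : ℝ) * x⌋ + 1 + R : ℤ) : ℝ) := by
            push_cast
            linarith [hx2.1]
          exact_mod_cast this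
      rw [if_pos hk]
      have h3 : |(k : ℝ)| ≤ (d : ℝ) * |x| + R := by
        calc |(k : ℝ)| = |d * x - (d * x - k)| := by ring_nf
          _ ≤ |d * x| + |d * x - k| := abs_sub _ _
          _ ≤ d * |x| + R := by
            rw [abs_mul, Nat.abs_cast]
            gcongr
      have h4 : ‖shift d φ 1 (b, k, σ) x‖ ≤ B := by
        rw [shift_eq_tagSign]
        exact (norm_le_pi_norm _ _).trans (hB _)
      gcongr
  calc ∑ k ∈ u, |(k : ℝ)| ^ i * ‖shift d φ 1 (b, k, σ) x‖
      ≤ ∑ k ∈ u, if k ∈ W then ((d : ℝ) * |x| + R) ^ i * B else 0 :=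
        Finset.sum_le_sum fun k _ => hterm k
    _ = ∑ k ∈ u with k ∈ W, ((d : ℝ) * |x| + R) ^ i * B := by rw [Finset.sum_filter]
    _ ≤ ∑ k ∈ W, ((d : ℝ) * |x| + R) ^ i * B := by
        refine Finset.sum_le_sum_of_subset_of_nonneg (fun k hk => (Finset.mem_filter.1 hk).2) ?_
        intros
        positivity
    _ = _ := by rw [Finset.sum_const, nsmul_eq_mul, hcard]

/-- Integrability of `x^j f` forces the absolute convergence of the discrete moments up to order
`j`. -/
theorem Recursion.summable_pow_mul_coeff (hd : 1 ≤ d) (horth : TwoDirection.Orthogonal φ)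
    {R : ℕ} (hR : ∀ y, (R : ℝ) < |y| → φ y = 0) (hcont : Continuous φ)
    (hf : Recursion d Cp Cm φ f) {i j : ℕ} (hij : i ≤ j)
    (hj : Integrable fun x : ℝ => x ^ j • f x) (a b : Fin r) (σ : Bool) :
    Summable fun k : ℤ => |(k : ℝ)| ^ i * |coeff Cp Cm σ k a b| := by
  obtain ⟨B, hB⟩ := (hasCompactSupport_of_abs hR).exists_bound_of_continuous hcont
  have hB0 : 0 ≤ B := (norm_nonneg _).trans (hB 0)
  have hfc := hf.continuous hR hcont
  have hf1 := integrable_of_integrable_pow_smul hfc hj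
  set K : ℝ := (2 * R + 2) * ((((d : ℝ) + R) ^ i * 2 ^ (j - 1)) * B) with hK
  have hdom : Integrable fun x : ℝ => K * (‖f x‖ + ‖x ^ j • f x‖) :=
    (hf1.norm.add hj.norm).const_mul K
  have hint : ∀ k : ℤ, Integrable fun x => ‖f x a‖ * ‖shift d φ 1 (b, k, σ) x‖ := by
    intro k
    refine Continuous.integrable_of_hasCompactSupport
      (((continuous_apply a).comp hfc).norm.mul (continuous_shift hcont 1 _).norm) ?_
    exact (hasCompactSupport_shift hd hR 1 _).norm.mul_left
  refine summable_of_sum_le (c := Real.sqrt d * ∫ x : ℝ, K * (‖f x‖ + ‖x ^ j • f x‖))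
    (fun k => by positivity) fun u => ?_
  -- After this bound, a finite partial sum can be moved under the integral, where the overlap
  -- estimate bounds it uniformly in `u`.
  have hcoef : ∀ k : ℤ, |coeff Cp Cm σ k a b|
      ≤ Real.sqrt d * ∫ x, ‖f x a‖ * ‖shift d φ 1 (b, k, σ) x‖ := by
    intro k
    have h := hf.coeff_eq hd horth hR hcont a b k σ
    rw [← Real.norm_eq_abs, ← norm_algebraMap' 𝕜, h, norm_mul, norm_algebraMap', Real.norm_eq_abs,
      abs_of_nonneg (Real.sqrt_nonneg _)]
    gcongr
    refine (norm_integral_le_integral_norm _).trans_eq ?_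
    simp only [norm_mul, norm_star]
  calc ∑ k ∈ u, |(k : ℝ)| ^ i * |coeff Cp Cm σ k a b|
      ≤ ∑ k ∈ u, |(k : ℝ)| ^ i * (Real.sqrt d * ∫ x, ‖f x a‖ * ‖shift d φ 1 (b, k, σ) x‖) := by
        gcongr
        exact hcoef _
    _ = Real.sqrt d * ∫ x, ∑ k ∈ u, |(k : ℝ)| ^ i * (‖f x a‖ * ‖shift d φ 1 (b, k, σ) x‖) := by
        rw [integral_finsetSum _ fun k _ => (hint k).const_mul _, Finset.mul_sum]
        refine Finset.sum_congr rfl fun k _ => ?_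
        rw [integral_const_mul]
        ring
    _ ≤ _ := by
        refine mul_le_mul_of_nonneg_left (integral_mono
          (integrable_finsetSum _ fun k _ => (hint k).const_mul _) hdom fun x => ?_)
          (Real.sqrt_nonneg _)
        calc ∑ k ∈ u, |(k : ℝ)| ^ i * (‖f x a‖ * ‖shift d φ 1 (b, k, σ) x‖)
            = ‖f x a‖ * ∑ k ∈ u, |(k : ℝ)| ^ i * ‖shift d φ 1 (b, k, σ) x‖ := by
              rw [Finset.mul_sum]
              exact Finset.sum_congr rfl fun k _ => by ring
          _ ≤ ‖f x‖ * ((2 * R + 2) * (((d : ℝ) * |x| + R) ^ i * B)) := by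
              gcongr
              · exact norm_le_pi_norm _ _
              · exact sum_pow_mul_norm_shift_le hR hB b σ i u x
          _ ≤ ‖f x‖ * ((2 * R + 2) *
                ((((d : ℝ) + R) ^ i * 2 ^ (j - 1) * (1 + |x| ^ j)) * B)) := by
              gcongr
              exact add_pow_le_mul_one_add_pow (by positivity) (by positivity) (abs_nonneg x) hij
          _ = K * (‖f x‖ + ‖x ^ j • f x‖) := by
              rw [norm_smul, norm_pow, Real.norm_eq_abs, hK]
              ring

theorem Recursion.summable_pow_smul_coeff (hd : 1 ≤ d) (horth : TwoDirection.Orthogonal φ)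
    {R : ℕ} (hR : ∀ y, (R : ℝ) < |y| → φ y = 0) (hcont : Continuous φ)
    (hf : Recursion d Cp Cm φ f) {i j : ℕ} (hij : i ≤ j)
    (hj : Integrable fun x : ℝ => x ^ j • f x) (σ : Bool) :
    Summable fun k : ℤ => (k : ℝ) ^ i • coeff Cp Cm σ k := by
  rw [summable_matrix_iff]
  intro a b
  refine Summable.of_norm ?_
  simpa [abs_mul] using hf.summable_pow_mul_coeff hd horth hR hcont hij hj a b σ

theorem integrable_pow_smul {R : ℕ} (hR : ∀ y, (R : ℝ) < |y| → φ y = 0) (hcont : Continuous φ)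
    (j : ℕ) : Integrable fun x : ℝ => x ^ j • φ x := by
  refine Continuous.integrable_of_hasCompactSupport (by fun_prop) ?_
  exact hasCompactSupport_of_abs (T := R) fun x hx => by rw [hR x hx, smul_zero]

/-- The substitution `y = dx`, a translation by `k` and a reflection turn `x^j` into `d^{-j} (±y +
k)^j`, which is expanded by the binomial theorem. -/
theorem integral_pow_smul_comp (hd : 1 ≤ d) {R : ℕ} (hR : ∀ y, (R : ℝ) < |y| → φ y = 0)
    (hcont : Continuous φ) (j : ℕ) (k : ℤ) (σ : Bool) :
    ∫ x : ℝ, x ^ j • φ (tagSign σ * (d * x - k))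
      = ((d : ℝ)⁻¹ * ((d : ℝ) ^ j)⁻¹) • ∑ l ∈ Finset.range (j + 1),
        ((j.choose l : ℝ) * (k : ℝ) ^ (j - l) * tagSign σ ^ l) • moment φ l := by
  have hd0 : (0 : ℝ) < d := by exact_mod_cast hd
  have hflip : ∀ g : ℝ → Fin r → 𝕜, ∫ y, g (tagSign σ * y) = ∫ y, g y := by
    intro g
    rw [Measure.integral_comp_mul_left, abs_inv, abs_tagSign, inv_one, one_smul]
  calc ∫ x : ℝ, x ^ j • φ (tagSign σ * (d * x - k))
      = ∫ x : ℝ, (fun y : ℝ => ((d : ℝ) ^ j)⁻¹ • y ^ j • φ (tagSign σ * (y - k))) (d * x) := by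
        refine integral_congr_ae (Filter.Eventually.of_forall fun x => ?_)
        simp only [smul_smul]
        congr 1
        rw [mul_pow]
        field_simp
    _ = (d : ℝ)⁻¹ • ((d : ℝ) ^ j)⁻¹ • ∫ y : ℝ, y ^ j • φ (tagSign σ * (y - k)) := by
        rw [Measure.integral_comp_mul_left (fun y : ℝ =>
          ((d : ℝ) ^ j)⁻¹ • y ^ j • φ (tagSign σ * (y - k))), integral_smul,
          abs_of_nonneg (by positivity)]
    _ = (d : ℝ)⁻¹ • ((d : ℝ) ^ j)⁻¹ • ∫ y : ℝ, (tagSign σ * y + k) ^ j • φ y := by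
        rw [← hflip (fun y => (tagSign σ * y + k) ^ j • φ y),
          ← integral_sub_right_eq_self
            (fun y : ℝ => (tagSign σ * (tagSign σ * y) + k) ^ j • φ (tagSign σ * y)) (k : ℝ)]
        congr 2
        refine integral_congr_ae (Filter.Eventually.of_forall fun y => ?_)
        simp only [← mul_assoc, tagSign_mul_self, one_mul, sub_add_cancel]
    _ = _ := by
        rw [smul_smul]
        congr 1
        have : ∀ y : ℝ, (tagSign σ * y + k) ^ j • φ y = ∑ l ∈ Finset.range (j + 1),
            ((j.choose l : ℝ) * (k : ℝ) ^ (j - l) * tagSign σ ^ l) • (y ^ l • φ y) := by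
          intro y
          rw [add_pow, Finset.sum_smul]
          refine Finset.sum_congr rfl fun l _ => ?_
          rw [smul_smul]
          congr 1
          rw [mul_pow]
          ring
        simp_rw [this]
        refine (integral_finsetSum _ fun l _ =>
          (integrable_pow_smul hR hcont l).smul
            ((j.choose l : ℝ) * (k : ℝ) ^ (j - l) * tagSign σ ^ l)).trans ?_
        refine Finset.sum_congr rfl fun l _ => ?_
        exact integral_smul ((j.choose l : ℝ) * (k : ℝ) ^ (j - l) * tagSign σ ^ l)
          (fun y : ℝ => y ^ l • φ y)

theorem integrable_pow_smul_comp (hd : 1 ≤ d) {R : ℕ} (hR : ∀ y, (R : ℝ) < |y| → φ y = 0)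
    (hcont : Continuous φ) (j : ℕ) (k : ℤ) (σ : Bool) :
    Integrable fun x : ℝ => x ^ j • φ (tagSign σ * (d * x - k)) := by
  refine Continuous.integrable_of_hasCompactSupport (by fun_prop)
    (hasCompactSupport_of_abs (T := |(k : ℝ)| + R) fun x hx => ?_)
  rw [hR, smul_zero]
  rw [abs_mul, abs_tagSign, one_mul]
  by_contra h
  exact absurd (abs_le_of_abs_sub_le (n := 1) hd (by simpa using h)) (not_le.2 hx)

/-- On the support `|x| ≤ |k| + R`. The growth in `k` is thus polynomial of degree `j`, which the
summability of the weighted coefficients can absorb. -/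
theorem integral_norm_pow_smul_comp_le (hd : 1 ≤ d) {R : ℕ}
    (hR : ∀ y, (R : ℝ) < |y| → φ y = 0) (hcont : Continuous φ) (j : ℕ) (k : ℤ) (σ : Bool) :
    ∫ x : ℝ, ‖x ^ j • φ (tagSign σ * (d * x - k))‖
      ≤ (|(k : ℝ)| + R) ^ j * ∫ x, ‖φ x‖ := by
  have hd0 : (0 : ℝ) < d := by exact_mod_cast hd
  have hint := integrable_pow_smul_comp hd hR hcont 0 k σ
  simp only [pow_zero, one_smul] at hint
  calc ∫ x : ℝ, ‖x ^ j • φ (tagSign σ * (d * x - k))‖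
      ≤ ∫ x : ℝ, (|(k : ℝ)| + R) ^ j * ‖φ (tagSign σ * (d * x - k))‖ := by
        refine integral_mono (integrable_pow_smul_comp hd hR hcont j k σ).norm
          (hint.norm.const_mul _) fun x => ?_
        simp only [norm_smul, norm_pow, Real.norm_eq_abs]
        by_cases hx : (R : ℝ) < |(d : ℝ) * x - k|
        · rw [hR _ (by rwa [abs_mul, abs_tagSign, one_mul]), norm_zero, mul_zero, mul_zero]
        · have := abs_le_of_abs_sub_le (n := 1) hd (by simpa using not_lt.1 hx)
          gcongr
    _ = (|(k : ℝ)| + R) ^ j * ((d : ℝ)⁻¹ * ∫ x, ‖φ x‖) := by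
        rw [integral_const_mul, Measure.integral_comp_mul_left
          (fun y => ‖φ (tagSign σ * (y - k))‖) (d : ℝ),
          integral_sub_right_eq_self (fun y => ‖φ (tagSign σ * y)‖) (k : ℝ),
          Measure.integral_comp_mul_left (fun y => ‖φ y‖), abs_inv (tagSign σ), abs_tagSign,
          inv_one, one_smul, abs_of_nonneg (inv_nonneg.2 hd0.le), smul_eq_mul]
    _ ≤ (|(k : ℝ)| + R) ^ j * ∫ x, ‖φ x‖ := by
        gcongr
        refine mul_le_of_le_one_left (by positivity) (inv_le_one_of_one_le₀ ?_)
        exact_mod_cast hd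

theorem recTerm_eq_tagSign (k : ℤ) (x : ℝ) :
    recTerm d Cp Cm φ k x = Real.sqrt d • (act (Cp k) (φ (tagSign true * (d * x - k)))
      + act (Cm k) (φ (tagSign false * (d * x - k)))) := by
  simp [recTerm, tagSign]

/-- The moments of a function given by a two-direction relation. -/
theorem Recursion.moment_eq (hd : 1 ≤ d) (horth : TwoDirection.Orthogonal φ)
    {R : ℕ} (hR : ∀ y, (R : ℝ) < |y| → φ y = 0) (hcont : Continuous φ)
    (hf : Recursion d Cp Cm φ f) {j : ℕ} (hj : Integrable fun x : ℝ => x ^ j • f x) :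
    moment f j = ((d : ℝ) ^ j)⁻¹ •
      ∑ l ∈ Finset.range (j + 1), sepTerm d Cp Cm j l (moment φ l) := by
  have hd0 : (0 : ℝ) < d := by exact_mod_cast hd
  set X : Bool → ℤ → ℝ → Fin r → 𝕜 := fun σ k x => x ^ j • φ (tagSign σ * (d * x - k)) with hX
  have hXint : ∀ σ k, Integrable (X σ k) := fun σ k => integrable_pow_smul_comp hd hR hcont j k σ
  have hterm : ∀ k x, x ^ j • recTerm d Cp Cm φ k x
      = Real.sqrt d • (actCLM (Cp k) (X true k x) + actCLM (Cm k) (X false k x)) := by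
    intro k x
    simp only [hX, recTerm_eq_tagSign, map_smul, ← actCLM_apply]
    rw [smul_comm, smul_add]
  have hFint : ∀ k, Integrable fun x : ℝ => x ^ j • recTerm d Cp Cm φ k x := by
    intro k
    simp only [hterm]
    exact ((((actCLM (Cp k)).integrable_comp (hXint true k)).add
      ((actCLM (Cm k)).integrable_comp (hXint false k))).smul (Real.sqrt d))
  have hIF : ∀ k, ∫ x : ℝ, x ^ j • recTerm d Cp Cm φ k x
      = Real.sqrt d • (act (Cp k) (∫ x, X true k x) + act (Cm k) (∫ x, X false k x)) := by
    intro k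
    simp only [hterm]
    rw [integral_smul, integral_add ((actCLM (Cp k)).integrable_comp (hXint true k))
      ((actCLM (Cm k)).integrable_comp (hXint false k)),
      (actCLM (Cp k)).integral_comp_comm (hXint true k),
      (actCLM (Cm k)).integral_comp_comm (hXint false k)]
    rfl
  -- This is the condition for termwise integration. The weight `(|k| + R)^j` is controlled by `1 +
  -- |k|^j`, hence by the coefficient sums of orders `0` and `j`.
  have hsumm : Summable fun k : ℤ => ∫ x : ℝ, ‖x ^ j • recTerm d Cp Cm φ k x‖ := by
    have hw : ∀ σ, Summable fun k : ℤ =>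
        (∑ a, ∑ b, |coeff Cp Cm σ k a b|) * ((|(k : ℝ)| + R) ^ j * ∫ x, ‖φ x‖) := by
      intro σ
      simp only [Finset.sum_mul]
      refine summable_sum fun a _ => summable_sum fun b _ => ?_
      have h0 := hf.summable_pow_mul_coeff hd horth hR hcont (Nat.zero_le j) hj a b σ
      have h1 := hf.summable_pow_mul_coeff hd horth hR hcont le_rfl hj a b σ
      refine Summable.of_nonneg_of_le (fun k => by positivity) (fun k => ?_)
        ((h0.add h1).mul_left ((1 + (R : ℝ)) ^ j * 2 ^ (j - 1) * ∫ x, ‖φ x‖))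
      have := add_pow_le_mul_one_add_pow (a := 1) (c := R) zero_le_one (by positivity)
        (abs_nonneg (k : ℝ)) (le_refl j)
      rw [one_mul] at this
      calc |coeff Cp Cm σ k a b| * ((|(k : ℝ)| + R) ^ j * ∫ x, ‖φ x‖)
          ≤ |coeff Cp Cm σ k a b| * (((1 + (R : ℝ)) ^ j * 2 ^ (j - 1) * (1 + |(k : ℝ)| ^ j)) *
              ∫ x, ‖φ x‖) := by
            gcongr
        _ = _ := by ring
    refine Summable.of_nonneg_of_le (fun k => by positivity) (fun k => ?_)
      (((hw true).add (hw false)).mul_left (Real.sqrt d))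
    calc ∫ x : ℝ, ‖x ^ j • recTerm d Cp Cm φ k x‖
        ≤ ∫ x, Real.sqrt d * ((∑ a, ∑ b, |Cp k a b|) * ‖X true k x‖ +
            (∑ a, ∑ b, |Cm k a b|) * ‖X false k x‖) := by
          refine integral_mono (hFint k).norm ((((hXint true k).norm.const_mul _).add
            ((hXint false k).norm.const_mul _)).const_mul _) fun x => ?_
          simp only [hterm, norm_smul, Real.norm_eq_abs, abs_of_nonneg (Real.sqrt_nonneg _)]
          gcongr
          exact (norm_add_le _ _).trans (add_le_add (norm_act_le _ _) (norm_act_le _ _))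
      _ = Real.sqrt d * ((∑ a, ∑ b, |Cp k a b|) * (∫ x, ‖X true k x‖) +
            (∑ a, ∑ b, |Cm k a b|) * ∫ x, ‖X false k x‖) := by
          rw [integral_const_mul, integral_add ((hXint true k).norm.const_mul _)
            ((hXint false k).norm.const_mul _), integral_const_mul, integral_const_mul]
      _ ≤ _ := by
          have h1 := integral_norm_pow_smul_comp_le hd hR hcont j k true
          have h2 := integral_norm_pow_smul_comp_le hd hR hcont j k false
          simp only [coeff, if_true, Bool.false_eq_true, if_false]
          gcongr
  have hsum := hasSum_integral_of_summable_integral_norm hFint hsumm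
  have hpt : ∀ x : ℝ, ∑' k, x ^ j • recTerm d Cp Cm φ k x = x ^ j • f x := fun x =>
    ((hf x).const_smul (x ^ j)).tsum_eq
  simp only [hpt] at hsum
  refine hsum.unique ?_
  have hC : ∀ i ≤ j, ∀ σ, HasSum (fun k : ℤ => (1 / Real.sqrt d) • (k : ℝ) ^ i • coeff Cp Cm σ k)
      (discreteMoment d (coeff Cp Cm σ) i) := fun i hi σ =>
    (hf.summable_pow_smul_coeff hd horth hR hcont hi hj σ).hasSum.const_smul _
  -- The claimed value is written as a series over `k` too, so that it can be compared with the
  -- integrated relation term by term.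
  have htarget : HasSum (fun k : ℤ => ((d : ℝ) ^ j)⁻¹ • ∑ l ∈ Finset.range (j + 1),
      (j.choose l : ℝ) • act ((1 / Real.sqrt d) • (k : ℝ) ^ (j - l) • Cp k +
        (-1 : ℝ) ^ l • (1 / Real.sqrt d) • (k : ℝ) ^ (j - l) • Cm k) (moment φ l))
      (((d : ℝ) ^ j)⁻¹ • ∑ l ∈ Finset.range (j + 1), sepTerm d Cp Cm j l (moment φ l)) := by
    refine HasSum.const_smul _ (hasSum_sum fun l _ => HasSum.const_smul _ (hasSum_act ?_ _))
    exact (hC (j - l) (Nat.sub_le _ _) true).add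
      ((hC (j - l) (Nat.sub_le _ _) false).const_smul _)
  convert! htarget using 1
  funext k
  -- The factor `√d` of the relation and the Jacobian `1/d` combine to the `1/√d` of the discrete
  -- moments.
  have hsq : Real.sqrt d * ((d : ℝ)⁻¹ * ((d : ℝ) ^ j)⁻¹) = ((d : ℝ) ^ j)⁻¹ * (1 / Real.sqrt d) := by
    have h1 : Real.sqrt d * Real.sqrt d = d := Real.mul_self_sqrt hd0.le
    have h2 : Real.sqrt d ≠ 0 := (Real.sqrt_pos.2 hd0).ne'
    field_simp
    rw [sq, h1]
  rw [hIF]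
  simp only [hX, integral_pow_smul_comp hd hR hcont, ← actCLM_apply, map_smul, map_sum]
  simp only [actCLM_apply, act_add_left, act_smul_left, ← smul_add, ← Finset.sum_add_distrib,
    smul_smul, hsq]
  rw [mul_smul, Finset.smul_sum]
  congr 1
  refine Finset.sum_congr rfl fun l _ => ?_
  simp only [smul_add, smul_smul, tagSign, if_true, Bool.false_eq_true, if_false]
  congr 2
  · ring
  · ring

end TwoDirection

/-! ### Orthonormal bases of the scale spaces. -/

namespace TwoDirection

/-- With only finitely many nonzero coefficients, `f` minus its finite expansion is orthogonal to
every `e p`, hence to their closed span. The expansion is therefore the projection, and Parseval is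
a finite sum. -/
theorem norm_sq_starProjection_closure_span {𝕜 E ι : Type*} [RCLike 𝕜] [NormedAddCommGroup E]
    [InnerProductSpace 𝕜 E] {e : ι → E} (he : Orthonormal 𝕜 e) {K : Submodule 𝕜 E}
    [K.HasOrthogonalProjection]
    (hK : K = (Submodule.span 𝕜 (Set.range e)).topologicalClosure) (f : E) (S : Finset ι)
    (hS : ∀ p ∉ S, inner 𝕜 (e p) f = 0) :
    ‖K.starProjection f‖ ^ 2 = ∑ p ∈ S, ‖inner 𝕜 (e p) f‖ ^ 2 := by
  classical
  set g := ∑ p ∈ S, inner 𝕜 (e p) f • e p with hg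
  have hgK : g ∈ K := by
    rw [hK]
    exact Submodule.le_topologicalClosure _ (Submodule.sum_mem _ fun p _ =>
      Submodule.smul_mem _ _ (Submodule.subset_span ⟨p, rfl⟩))
  have hort : ∀ p, inner 𝕜 (e p) (f - g) = 0 := by
    intro p
    rw [inner_sub_right]
    by_cases hp : p ∈ S
    · rw [hg, he.inner_right_sum _ hp, sub_self]
    · rw [hS p hp, hg, inner_sum, zero_sub, neg_eq_zero]
      refine Finset.sum_eq_zero fun q hq => ?_
      rw [inner_smul_right, he.2 (ne_of_mem_of_not_mem hq hp).symm, mul_zero]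
  have hle : K ≤ (Submodule.span 𝕜 {f - g})ᗮ := by
    rw [hK]
    refine Submodule.topologicalClosure_minimal _ ?_ (Submodule.isClosed_orthogonal _)
    rw [Submodule.span_le]
    rintro _ ⟨p, rfl⟩
    rw [SetLike.mem_coe, Submodule.mem_orthogonal_singleton_iff_inner_left]
    exact hort p
  have hproj : K.starProjection f = g := by
    refine Submodule.eq_starProjection_of_mem_of_inner_eq_zero hgK fun w hw => ?_
    exact Submodule.mem_orthogonal_singleton_iff_inner_right.1 (hle hw)
  rw [hproj]
  apply (algebraMap ℝ 𝕜).injective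
  have h := he.inner_sum (fun p => inner 𝕜 (e p) f) (fun p => inner 𝕜 (e p) f) S
  rw [← hg, inner_self_eq_norm_sq_to_K] at h
  rw [map_pow, map_sum]
  refine h.trans (Finset.sum_congr rfl fun p _ => ?_)
  rw [RCLike.conj_mul, map_pow]

variable {𝕜 : Type*} [RCLike 𝕜] {d r : ℕ} {φ : ℝ → Fin r → 𝕜}

/-- The normalized functions `d^{n/2} φ_i(dⁿ x - k)`, `d^{n/2} φ_i(k - dⁿ x)` are an orthonormal
family that spans `V_n`. -/
theorem exists_orthonormal_scaleSpace (hd : 1 ≤ d) (horth : TwoDirection.Orthogonal φ)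
    {R : ℕ} (hR : ∀ y, (R : ℝ) < |y| → φ y = 0) (hcont : Continuous φ) (n : ℕ) :
    ∃ e : Fin r × ℤ × Bool → Lp 𝕜 2 (volume : Measure ℝ), Orthonormal 𝕜 e ∧
      (∀ p, e p =ᵐ[volume]
        fun x => algebraMap ℝ 𝕜 (Real.sqrt ((d : ℝ) ^ n)) * shift d φ n p x) ∧
      scaleSpace d φ n = (Submodule.span 𝕜 (Set.range e)).topologicalClosure := by
  classical
  have hD : (0 : ℝ) < (d : ℝ) ^ n := pow_pos (by exact_mod_cast hd) n
  set c : 𝕜 := algebraMap ℝ 𝕜 (Real.sqrt ((d : ℝ) ^ n)) with hc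
  have hc0 : c ≠ 0 := by
    rw [hc, Ne, map_eq_zero]
    exact (Real.sqrt_pos.2 hD).ne'
  have hmem : ∀ p, MemLp (fun x => c * shift d φ n p x) 2 volume := fun p =>
    ((continuous_shift hcont n p).memLp_of_hasCompactSupport
      (hasCompactSupport_shift hd hR n p)).const_mul c
  set e : Fin r × ℤ × Bool → Lp 𝕜 2 (volume : Measure ℝ) := fun p => (hmem p).toLp with he
  have hcoe : ∀ p, e p =ᵐ[volume] fun x => c * shift d φ n p x := fun p => (hmem p).coeFn_toLp
  refine ⟨e, ?_, hcoe, ?_⟩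
  · rw [orthonormal_iff_ite]
    intro p q
    rw [L2.inner_def]
    have h1 : ∫ x, inner 𝕜 (e p x) (e q x)
        = ∫ x, (algebraMap ℝ 𝕜 ((d : ℝ) ^ n)) * (shift d φ n q x * star (shift d φ n p x)) := by
      refine integral_congr_ae ?_
      filter_upwards [hcoe p, hcoe q] with x hp hq
      rw [hp, hq, RCLike.inner_apply, map_mul, hc]
      have : (starRingEnd 𝕜) (algebraMap ℝ 𝕜 (Real.sqrt ((d : ℝ) ^ n)))
          = algebraMap ℝ 𝕜 (Real.sqrt ((d : ℝ) ^ n)) := RCLike.conj_ofReal _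
      rw [this, starRingEnd_apply]
      have h2 : algebraMap ℝ 𝕜 ((d : ℝ) ^ n) = algebraMap ℝ 𝕜 (Real.sqrt ((d : ℝ) ^ n)) *
          algebraMap ℝ 𝕜 (Real.sqrt ((d : ℝ) ^ n)) := by
        rw [← map_mul, Real.mul_self_sqrt hD.le]
      rw [h2]
      ring
    rw [h1, integral_const_mul, integral_shift_mul_star horth]
    simp only [eq_comm (a := q)]
    split_ifs
    · rw [zpow_natCast, ← map_mul, mul_inv_cancel₀ hD.ne', map_one]
    · rw [mul_zero]
  · have hiff : ∀ p (f : Lp 𝕜 2 (volume : Measure ℝ)),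
        f =ᵐ[volume] shift d φ n p ↔ c • f = e p := by
      intro p f
      rw [Lp.ext_iff]
      constructor
      · intro h
        filter_upwards [h, hcoe p, Lp.coeFn_smul c f] with x h1 h2 h3
        rw [h3, h2, Pi.smul_apply, h1, smul_eq_mul]
      · intro h
        filter_upwards [h, hcoe p, Lp.coeFn_smul c f] with x h1 h2 h3
        rw [h3, h2, Pi.smul_apply, smul_eq_mul] at h1
        exact mul_left_cancel₀ hc0 h1
    rw [scaleSpace]
    congr 1
    refine le_antisymm (Submodule.span_le.2 ?_) (Submodule.span_le.2 ?_)
    · rintro f ⟨p, hp⟩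
      rw [hiff] at hp
      have : f = c⁻¹ • e p := by rw [← hp, smul_smul, inv_mul_cancel₀ hc0, one_smul]
      rw [this]
      exact Submodule.smul_mem _ _ (Submodule.subset_span ⟨p, rfl⟩)
    · rintro _ ⟨p, rfl⟩
      have : e p = c • (c⁻¹ • e p) := by rw [smul_smul, mul_inv_cancel₀ hc0, one_smul]
      rw [this]
      exact Submodule.smul_mem _ _ (Submodule.subset_span ⟨p, (hiff p _).2 this.symm⟩)

theorem integral_comp_affine {E : Type*} [NormedAddCommGroup E] [NormedSpace ℝ E] (g : ℝ → E)
    {a : ℝ} (ha : 0 ≤ a) (σ : Bool) (k : ℝ) :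
    ∫ x, g (tagSign σ * (a * x - k)) = a⁻¹ • ∫ x, g x := by
  rw [Measure.integral_comp_mul_left (fun y => g (tagSign σ * (y - k))) a,
    integral_sub_right_eq_self (fun y => g (tagSign σ * y)) k,
    Measure.integral_comp_mul_left g, abs_inv (tagSign σ), abs_tagSign,
    inv_one, one_smul, abs_of_nonneg (inv_nonneg.2 ha)]

theorem moment_zero_apply {R : ℕ} (hR : ∀ y, (R : ℝ) < |y| → φ y = 0) (hcont : Continuous φ)
    (b : Fin r) : moment φ 0 b = ∫ x, φ x b := by
  simp only [moment, pow_zero, one_smul]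
  have := integrable_pow_smul hR hcont 0
  simp only [pow_zero, one_smul] at this
  exact eval_integral (fun i => this.eval i) b

/-! ### Integrals of the shifts over `[0,1]` and the normalization of `m_0`. -/

section unitInterval

variable {R : ℕ} (n : ℕ) (b : Fin r) (k : ℤ) (σ : Bool)

/-- For these `k` the shift vanishes off `[0,1]`, so the integral is over the whole line. -/
theorem setIntegral_shift_of_inner (hd : 1 ≤ d) (hR : ∀ y, (R : ℝ) < |y| → φ y = 0)
    (hcont : Continuous φ) (h1 : (R : ℤ) ≤ k) (h2 : k ≤ (d ^ n : ℕ) - R) :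
    ∫ x in Set.Icc (0 : ℝ) 1, shift d φ n (b, k, σ) x = ((d : ℝ) ^ n)⁻¹ • moment φ 0 b := by
  have hD : (0 : ℝ) < (d : ℝ) ^ n := pow_pos (by exact_mod_cast hd) n
  have h1' : (R : ℝ) ≤ k := by exact_mod_cast h1
  have h2' : (k : ℝ) ≤ (d : ℝ) ^ n - R := by
    have : (k : ℝ) ≤ (((d ^ n : ℕ) - R : ℤ) : ℝ) := by exact_mod_cast h2
    push_cast at this
    exact this
  rw [setIntegral_eq_integral_of_forall_compl_eq_zero, moment_zero_apply hR hcont]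
  · simp only [shift_eq_tagSign, zpow_natCast]
    exact integral_comp_affine (fun y => φ y b) hD.le σ k
  · intro x hx
    refine shift_eq_zero hR ?_
    rw [zpow_natCast]
    change (R : ℝ) < |(d : ℝ) ^ n * x - k|
    rw [Set.mem_Icc, not_and_or, not_le, not_le] at hx
    rcases hx with hx | hx
    · rw [lt_abs]
      right
      nlinarith
    · rw [lt_abs]
      left
      nlinarith

theorem setIntegral_shift_of_outer (hR : ∀ y, (R : ℝ) < |y| → φ y = 0)
    (h : k ∉ Finset.Icc (-R : ℤ) ((d ^ n : ℕ) + R)) :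
    ∫ x in Set.Icc (0 : ℝ) 1, shift d φ n (b, k, σ) x = 0 := by
  refine setIntegral_eq_zero_of_forall_eq_zero fun x hx => shift_eq_zero hR ?_
  have hD : (0 : ℝ) ≤ (d : ℝ) ^ n := by positivity
  rw [zpow_natCast]
  change (R : ℝ) < |(d : ℝ) ^ n * x - k|
  rw [Finset.mem_Icc, not_and_or, not_le, not_le] at h
  rw [lt_abs]
  rcases h with h | h
  · left
    have : (k : ℝ) < -R := by exact_mod_cast h
    nlinarith [hx.1]
  · right
    have : (d : ℝ) ^ n + R < k := by exact_mod_cast h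
    nlinarith [hx.2]

theorem norm_setIntegral_shift_le (hd : 1 ≤ d) (hR : ∀ y, (R : ℝ) < |y| → φ y = 0)
    (hcont : Continuous φ) :
    ‖∫ x in Set.Icc (0 : ℝ) 1, shift d φ n (b, k, σ) x‖
      ≤ ((d : ℝ) ^ n)⁻¹ * ∫ x, ‖φ x b‖ := by
  have hint : Integrable (shift d φ n (b, k, σ)) :=
    (continuous_shift hcont n _).integrable_of_hasCompactSupport
      (hasCompactSupport_shift hd hR n _)
  calc ‖∫ x in Set.Icc (0 : ℝ) 1, shift d φ n (b, k, σ) x‖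
      ≤ ∫ x in Set.Icc (0 : ℝ) 1, ‖shift d φ n (b, k, σ) x‖ := norm_integral_le_integral_norm _
    _ ≤ ∫ x, ‖shift d φ n (b, k, σ) x‖ :=
        setIntegral_le_integral hint.norm (Filter.Eventually.of_forall fun x => norm_nonneg _)
    _ = _ := by
        simp only [shift_eq_tagSign, zpow_natCast]
        exact integral_comp_affine (fun y => ‖φ y b‖) (by positivity) σ k

/-- The window has `d^n + 2R + 1` indices. The interior ones contribute exactly `d^{-n}
|m_{0,b}|^2`, and only the two boundary strips produce an error. -/
theorem abs_sum_setIntegral_shift_sub_le (hd : 1 ≤ d) (hR : ∀ y, (R : ℝ) < |y| → φ y = 0)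
    (hcont : Continuous φ) :
    |(∑ k ∈ Finset.Icc (-R : ℤ) ((d ^ n : ℕ) + R),
        (d : ℝ) ^ n * ‖∫ x in Set.Icc (0 : ℝ) 1, shift d φ n (b, k, σ) x‖ ^ 2)
      - ((d : ℝ) ^ n + (2 * R + 1)) * (((d : ℝ) ^ n)⁻¹ * ‖moment φ 0 b‖ ^ 2)|
      ≤ (4 * R + 2) * (((d : ℝ) ^ n)⁻¹ * (∫ x, ‖φ x b‖) ^ 2) := by
  have hD : (0 : ℝ) < (d : ℝ) ^ n := pow_pos (by exact_mod_cast hd) n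
  set D : ℝ := (d : ℝ) ^ n with hDdef
  set L : ℝ := ∫ x, ‖φ x b‖ with hL
  set I : ℤ → ℝ := fun k => ‖∫ x in Set.Icc (0 : ℝ) 1, shift d φ n (b, k, σ) x‖ with hI
  set m : ℝ := ‖moment φ 0 b‖ with hm
  set W : Finset ℤ := Finset.Icc (-R : ℤ) ((d ^ n : ℕ) + R) with hW
  -- The two strips have `2R + 1` integers each. They may overlap for small `n`, which the bound on
  -- the cardinality of the union allows.
  set Z : Finset ℤ := Finset.Icc (-R : ℤ) R ∪ Finset.Icc ((d ^ n : ℕ) - R : ℤ) ((d ^ n : ℕ) + R)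
    with hZ
  have hWcard : (W.card : ℝ) = D + (2 * R + 1) := by
    rw [hW, Int.card_Icc]
    have : ((d ^ n : ℕ) + R + 1 - (-R : ℤ) : ℤ) = ((d ^ n + (2 * R + 1) : ℕ) : ℤ) := by
      push_cast
      ring
    rw [this, Int.toNat_natCast]
    push_cast
    ring
  have hZcard : (Z.card : ℝ) ≤ 4 * R + 2 := by
    have h1 : Z.card ≤ 4 * R + 2 := by
      refine (Finset.card_union_le _ _).trans ?_
      rw [Int.card_Icc, Int.card_Icc]
      omega
    exact_mod_cast h1
  have hm_le : m ≤ L := by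
    rw [hm, hL, moment_zero_apply hR hcont]
    exact norm_integral_le_integral_norm _
  have hL0 : 0 ≤ L := (norm_nonneg _).trans hm_le
  have hsq : D * (D⁻¹ * L) ^ 2 = D⁻¹ * L ^ 2 := by
    field_simp
  have hterm : ∀ k ∈ W, |D * I k ^ 2 - D⁻¹ * m ^ 2| ≤ if k ∈ Z then D⁻¹ * L ^ 2 else 0 := by
    intro k hk
    -- On the strips both numbers lie in `[0, D⁻¹ L²]`; off them they are equal.
    split_ifs with hkZ
    · have h1 : D * I k ^ 2 ≤ D⁻¹ * L ^ 2 := by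
        rw [← hsq]
        have := norm_setIntegral_shift_le n b k σ hd hR hcont
        have h0 : 0 ≤ I k := norm_nonneg _
        gcongr
      have h2 : D⁻¹ * m ^ 2 ≤ D⁻¹ * L ^ 2 := by gcongr
      have h3 : 0 ≤ D * I k ^ 2 := by positivity
      have h4 : 0 ≤ D⁻¹ * m ^ 2 := by positivity
      rw [abs_le]
      constructor <;> linarith
    · have hIk : I k = D⁻¹ * m := by
        simp only [hI]
        rw [setIntegral_shift_of_inner n b k σ hd hR hcont, norm_smul, norm_inv,
          Real.norm_of_nonneg hD.le]
        · simp only [hZ, hW, Finset.mem_union, Finset.mem_Icc] at hkZ hk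
          omega
        · simp only [hZ, hW, Finset.mem_union, Finset.mem_Icc] at hkZ hk
          omega
      rw [hIk]
      have : D * (D⁻¹ * m) ^ 2 = D⁻¹ * m ^ 2 := by field_simp
      rw [this, sub_self, abs_zero]
  have hconst : (D + (2 * R + 1)) * (D⁻¹ * m ^ 2) = ∑ k ∈ W, D⁻¹ * m ^ 2 := by
    rw [Finset.sum_const, nsmul_eq_mul, hWcard]
  rw [hconst, ← Finset.sum_sub_distrib]
  calc |∑ k ∈ W, (D * I k ^ 2 - D⁻¹ * m ^ 2)|
      ≤ ∑ k ∈ W, |D * I k ^ 2 - D⁻¹ * m ^ 2| := Finset.abs_sum_le_sum_abs _ _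
    _ ≤ ∑ k ∈ W, if k ∈ Z then D⁻¹ * L ^ 2 else 0 := Finset.sum_le_sum hterm
    _ = ∑ k ∈ W with k ∈ Z, D⁻¹ * L ^ 2 := by rw [Finset.sum_filter]
    _ ≤ ∑ k ∈ Z, D⁻¹ * L ^ 2 := by
        refine Finset.sum_le_sum_of_subset_of_nonneg (fun k hk => (Finset.mem_filter.1 hk).2) ?_
        intros
        positivity
    _ = Z.card * (D⁻¹ * L ^ 2) := by rw [Finset.sum_const, nsmul_eq_mul]
    _ ≤ _ := by gcongr

end unitInterval

open Filter Topology in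
theorem tendsto_sum_setIntegral_shift (hd : 2 ≤ d) {R : ℕ} (hR : ∀ y, (R : ℝ) < |y| → φ y = 0)
    (hcont : Continuous φ) (b : Fin r) (σ : Bool) :
    Tendsto (fun n : ℕ => ∑ k ∈ Finset.Icc (-R : ℤ) ((d ^ n : ℕ) + R),
        (d : ℝ) ^ n * ‖∫ x in Set.Icc (0 : ℝ) 1, shift d φ n (b, k, σ) x‖ ^ 2)
      atTop (𝓝 (‖moment φ 0 b‖ ^ 2)) := by
  have hd1 : (1 : ℝ) < d := by exact_mod_cast hd
  have hinv : Tendsto (fun n : ℕ => ((d : ℝ) ^ n)⁻¹) atTop (𝓝 0) :=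
    (tendsto_pow_atTop_atTop_of_one_lt hd1).inv_tendsto_atTop
  have hmain : Tendsto (fun n : ℕ =>
      ((d : ℝ) ^ n + (2 * R + 1)) * (((d : ℝ) ^ n)⁻¹ * ‖moment φ 0 b‖ ^ 2))
      atTop (𝓝 (‖moment φ 0 b‖ ^ 2)) := by
    have h := ((hinv.const_mul (2 * (R : ℝ) + 1)).const_add 1).mul_const (‖moment φ 0 b‖ ^ 2)
    rw [mul_zero, add_zero, one_mul] at h
    refine h.congr fun n => ?_
    have : (d : ℝ) ^ n ≠ 0 := by positivity
    field_simp
  have herr : Tendsto (fun n : ℕ =>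
      (4 * (R : ℝ) + 2) * (((d : ℝ) ^ n)⁻¹ * (∫ x, ‖φ x b‖) ^ 2)) atTop (𝓝 0) := by
    have h := (hinv.mul_const ((∫ x, ‖φ x b‖) ^ 2)).const_mul (4 * (R : ℝ) + 2)
    rwa [zero_mul, mul_zero] at h
  refine tendsto_of_tendsto_of_dist hmain (squeeze_zero (fun _ => dist_nonneg) (fun n => ?_) herr)
  rw [dist_comm, Real.dist_eq]
  exact abs_sum_setIntegral_shift_sub_le n b σ (one_le_two.trans hd) hR hcont

open Filter Topology in
theorem sum_norm_sq_moment_zero (hd : 2 ≤ d) (horth : TwoDirection.Orthogonal φ)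
    {R : ℕ} (hR : ∀ y, (R : ℝ) < |y| → φ y = 0) (hcont : Continuous φ)
    (hmra : IsMRA d (scaleSpace d φ)) : ∑ b, ‖moment φ 0 b‖ ^ 2 = 1 / 2 := by
  have : ∀ n, (scaleSpace d φ n).HasOrthogonalProjection := fun n =>
    have : CompleteSpace (scaleSpace d φ n) := (hmra.closed n).completeSpace_coe
    inferInstance
  -- The test function is the indicator of `[0,1]`, of norm `1`: its inner products with the basis
  -- are the integrals estimated above.
  set f : Lp 𝕜 2 (volume : Measure ℝ) :=
    indicatorConstLp 2 (measurableSet_Icc (a := (0 : ℝ)) (b := 1)) (by simp) 1 with hf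
  have hnorm : ‖f‖ = 1 := by
    rw [hf, norm_indicatorConstLp (by simp) (by simp)]
    simp
  have hproj : Tendsto (fun n : ℕ => ‖(scaleSpace d φ n).starProjection f‖ ^ 2) atTop (𝓝 1) := by
    have h := Submodule.starProjection_tendsto_self (scaleSpace d φ)
      (monotone_int_of_le_succ hmra.nested) f hmra.dense.ge
    have h2 := (h.comp (tendsto_natCast_atTop_atTop (R := ℤ))).norm.pow 2
    rw [hnorm, one_pow] at h2
    exact h2
  have hval : ∀ n : ℕ, ‖(scaleSpace d φ n).starProjection f‖ ^ 2 =
      ∑ b, ∑ σ, ∑ k ∈ Finset.Icc (-R : ℤ) ((d ^ n : ℕ) + R),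
        (d : ℝ) ^ n * ‖∫ x in Set.Icc (0 : ℝ) 1, shift d φ n (b, k, σ) x‖ ^ 2 := by
    intro n
    obtain ⟨e, he, hcoe, hspan⟩ :=
      exists_orthonormal_scaleSpace (one_le_two.trans hd) horth hR hcont n
    have hinner : ∀ p, ‖inner 𝕜 (e p) f‖ =
        Real.sqrt ((d : ℝ) ^ n) * ‖∫ x in Set.Icc (0 : ℝ) 1, shift d φ n p x‖ := by
      intro p
      rw [norm_inner_symm, hf, L2.inner_indicatorConstLp_one,
        setIntegral_congr_ae measurableSet_Icc ((hcoe p).mono fun x hx _ => hx),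
        integral_const_mul, norm_mul, norm_algebraMap', Real.norm_of_nonneg (Real.sqrt_nonneg _)]
    rw [norm_sq_starProjection_closure_span he hspan f
      (Finset.univ ×ˢ (Finset.Icc (-R : ℤ) ((d ^ n : ℕ) + R) ×ˢ Finset.univ))]
    · rw [Finset.sum_product]
      refine Finset.sum_congr rfl fun b _ => ?_
      rw [Finset.sum_product, Finset.sum_comm]
      refine Finset.sum_congr rfl fun σ _ => Finset.sum_congr rfl fun k _ => ?_
      rw [hinner, mul_pow, Real.sq_sqrt (by positivity)]
    · rintro ⟨b, k, σ⟩ hp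
      rw [← norm_eq_zero, hinner, setIntegral_shift_of_outer n b k σ hR, norm_zero, mul_zero]
      simpa using hp
  simp only [hval] at hproj
  -- The limit does not depend on the orientation `σ`; summing over its two values is the source of
  -- the `1/2`.
  have hlim : Tendsto (fun n : ℕ => ∑ b, ∑ σ, ∑ k ∈ Finset.Icc (-R : ℤ) ((d ^ n : ℕ) + R),
        (d : ℝ) ^ n * ‖∫ x in Set.Icc (0 : ℝ) 1, shift d φ n (b, k, σ) x‖ ^ 2) atTop
      (𝓝 (∑ b, ∑ _σ : Bool, ‖moment φ 0 b‖ ^ 2)) :=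
    tendsto_finsetSum _ fun b _ => tendsto_finsetSum _ fun σ _ =>
      tendsto_sum_setIntegral_shift hd hR hcont b σ
  have := tendsto_nhds_unique hlim hproj
  simp only [Finset.sum_const, Finset.card_univ, Fintype.card_bool, nsmul_eq_mul,
    ← Finset.mul_sum] at this
  push_cast at this
  linarith

theorem star_dotProduct_self (v : Fin r → 𝕜) :
    star v ⬝ᵥ v = algebraMap ℝ 𝕜 (∑ b, ‖v b‖ ^ 2) := by
  rw [dotProduct, map_sum]
  refine Finset.sum_congr rfl fun b _ => ?_
  rw [Pi.star_apply, ← starRingEnd_apply, RCLike.conj_mul, map_pow]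

end TwoDirection

/-! ### The moment theorem. -/

theorem theorem4p2 {𝕜 : Type*} [RCLike 𝕜] {d r : ℕ} (hd : 2 ≤ d)
    (Pp Pm : ℤ → Matrix (Fin r) (Fin r) ℝ) (φ : ℝ → Fin r → 𝕜)
    (hφ : IsMultiscaling d Pp Pm φ) (horth : TwoDirection.Orthogonal φ)
    (hsupp : HasCompactSupport φ) (hcont : Continuous φ)
    (hE : ConditionE ((doubledMask d Pp Pm).map (algebraMap ℝ ℂ)))
    (Qp Qm : Fin (d - 1) → ℤ → Matrix (Fin r) (Fin r) ℝ) (ψ : Fin (d - 1) → ℝ → Fin r → 𝕜)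
    (hψ : ∀ s, Recursion d (Qp s) (Qm s) φ (ψ s)) :
    -- the sums and integrals that define the moments of `φ` make sense
    ((Function.support Pp).Finite ∧ (Function.support Pm).Finite ∧
      ∀ j : ℕ, Integrable (fun x : ℝ => (x ^ j) • φ x)) ∧
    -- `m_0` is the eigenvector of `M_0` for the eigenvalue `1`, normalized by `m_0^* m_0 = 1/2`
    (act (discreteMoment d (fun k => Pp k + Pm k) 0) (moment φ 0) = moment φ 0 ∧
      star (moment φ 0) ⬝ᵥ moment φ 0 = 1 / 2 ∧
      ∀ v : Fin r → 𝕜, act (discreteMoment d (fun k => Pp k + Pm k) 0) v = v →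
        star v ⬝ᵥ v = 1 / 2 → ∃ c : 𝕜, ‖c‖ = 1 ∧ v = c • moment φ 0) ∧
    -- the recursion for the higher moments of `φ`
    (∀ j : ℕ, 1 ≤ j →
      IsUnit (sepMatrix d Pp Pm j) ∧
      moment φ j =
        act (sepMatrix d Pp Pm j)⁻¹ (∑ l ∈ Finset.range j, sepTerm d Pp Pm j l (moment φ l))) ∧
    -- all moments are determined by `m_0` and the recursion
    (∀ v : ℕ → Fin r → 𝕜, v 0 = moment φ 0 →
      (∀ j : ℕ, 1 ≤ j →
        v j = act (sepMatrix d Pp Pm j)⁻¹ (∑ l ∈ Finset.range j, sepTerm d Pp Pm j l (v l))) →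
      v = moment φ) ∧
    -- the moments of the multiwavelets, whenever they exist
    (∀ (s : Fin (d - 1)) (j : ℕ), Integrable (fun x : ℝ => (x ^ j) • ψ s x) →
      (∀ i ≤ j, Summable (fun k : ℤ => (k : ℝ) ^ i • Qp s k) ∧
        Summable (fun k : ℤ => (k : ℝ) ^ i • Qm s k)) ∧
      moment (ψ s) j =
        ((d : ℝ) ^ j)⁻¹ •
          ∑ l ∈ Finset.range (j + 1), sepTerm d (Qp s) (Qm s) j l (moment φ l)) := by
  obtain ⟨R, hR⟩ := exists_support_bound hsupp
  have hd1 : 1 ≤ d := by omega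
  have hrec := hφ.recursion
  have hfp : (Function.support Pp).Finite := hrec.finite_support hd1 horth hR hcont true
  have hfm : (Function.support Pm).Finite := hrec.finite_support hd1 horth hR hcont false
  have hsp : Summable Pp := summable_of_hasFiniteSupport hfp
  have hsm : Summable Pm := summable_of_hasFiniteSupport hfm
  have hint := integrable_pow_smul hR hcont
  have hM0 : discreteMoment d (fun k => Pp k + Pm k) 0
      = discreteMoment d Pp 0 + discreteMoment d Pm 0 := by
    simp only [discreteMoment, pow_zero, one_smul]
    rw [hsp.tsum_add hsm, smul_add]
  -- This is the moment formula at `j = 0`, where the factor `d^j` is `1`.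
  have heig : act (discreteMoment d Pp 0 + discreteMoment d Pm 0) (moment φ 0) = moment φ 0 := by
    have h := hrec.moment_eq hd1 horth hR hcont (hint 0)
    simpa [sepTerm] using h.symm
  have hnorm := sum_norm_sq_moment_zero hd horth hR hcont hφ.mra.1
  have hmom : ∀ j : ℕ, 1 ≤ j → IsUnit (sepMatrix d Pp Pm j) ∧ moment φ j =
      act (sepMatrix d Pp Pm j)⁻¹ (∑ l ∈ Finset.range j, sepTerm d Pp Pm j l (moment φ l)) := by
    intro j hj
    have hu := isUnit_sepMatrix hd hsp hsm hE hj
    refine ⟨hu, ?_⟩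
    have hdj : (d : ℝ) ^ j ≠ 0 := pow_ne_zero _ (by positivity)
    have h := hrec.moment_eq hd1 horth hR hcont (hint j)
    -- The `ℓ = j` summand contains the unknown moment; moving it to the left produces `sepMatrix`.
    rw [eq_inv_smul_iff₀ hdj, Finset.sum_range_succ, ← sub_eq_iff_eq_add] at h
    have hsep : act (sepMatrix d Pp Pm j) (moment φ j)
        = ∑ l ∈ Finset.range j, sepTerm d Pp Pm j l (moment φ l) := by
      rw [← h, sepMatrix, act_sub_left, act_smul_left, act_one]
      simp [sepTerm]
    rw [← hsep, ← act_mul, Matrix.nonsing_inv_mul _ ((Matrix.isUnit_iff_isUnit_det _).1 hu),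
      act_one]
  have hhalf : algebraMap ℝ 𝕜 (1 / 2) = 1 / 2 := by rw [map_div₀, map_one, map_ofNat]
  refine ⟨⟨hfp, hfm, hint⟩, ⟨by rw [hM0, heig], ?_, ?_⟩, hmom, ?_, ?_⟩
  · rw [star_dotProduct_self, hnorm, hhalf]
  · intro v hv hv1
    rw [hM0] at hv
    have hm0 : moment φ 0 ≠ 0 := by
      intro h
      rw [h] at hnorm
      norm_num at hnorm
    obtain ⟨c, rfl⟩ := exists_smul_of_act_eq hsp hsm hE hv heig hm0
    refine ⟨c, ?_, rfl⟩
    rw [star_dotProduct_self] at hv1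
    have h2 : ∑ b, ‖(c • moment φ 0) b‖ ^ 2 = 1 / 2 := by
      apply (algebraMap ℝ 𝕜).injective
      rw [hv1, hhalf]
    simp only [Pi.smul_apply, norm_smul, mul_pow, ← Finset.mul_sum, hnorm] at h2
    -- Both vectors have squared norm `1/2`, which forces `|c| = 1`.
    have h3 : ‖c‖ ^ 2 = 1 := by linarith
    exact (pow_eq_one_iff_of_nonneg (norm_nonneg c) two_ne_zero).1 h3
  · intro v hv0 hv
    funext j
    induction j using Nat.strong_induction_on with
    | _ j ih =>
      rcases Nat.eq_zero_or_pos j with rfl | hj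
      · exact hv0
      · rw [hv j hj, (hmom j hj).2]
        congr 1
        exact Finset.sum_congr rfl fun l hl => by rw [ih l (Finset.mem_range.1 hl)]
  · intro s j hj
    exact ⟨fun i hi => ⟨(hψ s).summable_pow_smul_coeff hd1 horth hR hcont hi hj true,
      (hψ s).summable_pow_smul_coeff hd1 horth hR hcont hi hj false⟩,
      (hψ s).moment_eq hd1 horth hR hcont hj⟩
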